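/- Let $F(x)=f(x)+h(x)+g(Kx)$ with $K\in\mathbb R^{d\times p}$, $f(x)=\sum_{j=1}^n f_j(x_j)$ and $g(r)=\sum_{i=1}^m g_i(r_i)$ block separable ($m,n\ge 1$; $x_j\in\mathbb R^{p_j}$, $r_i\in\mathbb R^{d_i}$), and put $\phi=f+h$, $G(y)=\phi^*(-K^\top y)+g^*(y)$, $F^\star=\inf F$. Assume that $f,g$ are proper, closed and convex with values in $\mathbb R\cup\{+\infty\}$; $h$ is convex, differentiable and satisfies $\|\nabla_{x_j}h(x+U_jd_j)-\nabla_{x_j}h(x)\|\le L^h_j\|d_j\|$ for all $x,j,d_j$, where $U_j$ is the inclusion of the $j$-th block; the set $\mathcal X^\star$ of minimizers of $F$ is nonempty; and $0\in\mathrm{ri}(\mathrm{dom}\,g-K\,\mathrm{dom}\,\phi)$. Assume that each $f_j$ is $\mu_{f_j}$-strongly convex with $\mu_{f_j}>0$ and each $g_i$ is $\mu_{g_i}$-strongly convex with $\mu_{g_i}>0$. Let $\mathcal Y^\star$ be the set of minimizers of $G$. Given weights $\sigma_j>0$, let $\bar L_\sigma=\|K\,\mathrm{diag}(1/\sqrt\sigma)\|^2$,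 $L^h_\sigma=\max_j L^h_j/\sigma_j$, $\mu_g=\min_i\mu_{g_i}$, $\mu^f_\sigma=\min_j\mu_{f_j}/\sigma_j$; assume $L^h_\sigma+\bar L_\sigma>0$, so that $\beta_k$ below is well defined. Let $\hat q_i=1/m$, $q_j=1/n$, $\tau_0=\min\{1/m,1/n\}$. Let $c\ge 2$ with $c\tau_0>2$, let $\rho_0>0$ with $\rho_0\le\frac18\mu_g$ and $\rho_0\bar L_\sigma\le\frac18\mu^f_\sigma$, and for $k\ge0$ let $$\tau_k=\frac{c\tau_0}{k+c},\quad \rho_k=\frac{\rho_0\tau_0^2}{\tau_k^2},\quad \gamma_k=\frac1{4\rho_k},\quad \beta_k=\frac1{L^h_\sigma+4\bar L_\sigma\rho_k},\quad \eta_k=\frac{\rho_k}2 .$$ Let $x^0\in\mathrm{dom}\,f$ and $\hat y^0\in\mathbb R^d$. Start from $\tilde x^0=x^0$, $r^0=\tilde r^0=Kx^0$, and for $k=0,1,\dots$ set $\hat r^k=(1-\tau_k)r^k+\tau_k\tilde r^k$, $\hat x^k=(1-\tau_k)x^k+\tau_k\tilde x^k$; draw independent, uniformly distributed $i_k\in\{1,\dots,m\}$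 and $j_k\in\{1,\dots,n\}$, independently of the past; keep all blocks of $\tilde r^k,\tilde x^k$ except, for $i=i_k$ and $j=j_k$, $$\tilde r_i^{k+1}=\mathrm{prox}_{\gamma_k\tau_0g_i/\tau_k}\Big(\tilde r_i^k-\tfrac{\tau_0\gamma_k}{\tau_k}\big[-\hat y_i^k+\rho_k(\hat r_i^k-(K\hat x^k)_i)\big]\Big),$$ $$\tilde x_j^{k+1}=\mathrm{prox}_{\tau_0\beta_kf_j/(\tau_k\sigma_j)}\Big(\tilde x_j^k-\tfrac{\tau_0\beta_k}{\tau_k\sigma_j}\big[\nabla_{x_j}h(\hat x^k)+(K^\top(\hat y^k+\rho_k(K\hat x^k-\hat r^k)))_j\big]\Big);$$ then set $r^{k+1}=\hat r^k+\frac{\tau_k}{\tau_0}(\tilde r^{k+1}-\tilde r^k)$, $x^{k+1}=\hat x^k+\frac{\tau_k}{\tau_0}(\tilde x^{k+1}-\tilde x^k)$ and $\hat y^{k+1}=\hat y^k+\eta_k[Kx^{k+1}-r^{k+1}-(1-\tau_k)(Kx^k-r^k)]$. Here $\mathrm{prox}_\psi(u)=\arg\min_v\{\psi(v)+\frac12\|v-u\|^2\}$.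 Suppose further that $g$ is $M_g$-Lipschitz continuous ($M_g\ge0$) at the points of $K(\mathrm{dom}\,f)$, in the sense that $g(u)\le g(v)+M_g\|u-v\|$ for all $u\in K(\mathrm{dom}\,f)$ and $v\in\mathbb R^d$ (for instance, $K(\mathrm{dom}\,f)\subseteq\mathrm{dom}\,g$ and $g$ is $M_g$-Lipschitz on $\mathrm{dom}\,g$). Then $F(x^k)$ is almost surely finite and integrable for every $k\ge0$, and for all $x^\star\in\mathcal X^\star$, $y^\star\in\mathcal Y^\star$ and $k\ge0$ $$\mathbb E[F(x^k)-F^\star]\le\frac{c^2\hat{\mathcal E}_0^2+c^2(M_g+\|y^\star\|)\,\hat{\mathcal E}_0\sqrt{2/\rho_0}}{(k+c-1)^2},$$ where $$\hat{\mathcal E}_0^2=F(x^0)-F^\star+\tfrac1{\rho_0}\|\hat y^0-y^\star\|^2+\tfrac{(L^h_\sigma+4\rho_0\bar L_\sigma+\mu^f_\sigma)\tau_0}2\sum_j\tfrac{\sigma_j}{q_j}\|x^0_j-x^\star_j\|^2+\tfrac{\tau_0(4\rho_0+\mu_g)}2\sum_i\tfrac1{\hat q_i}\|(K(x^0-x^\star))_i\|^2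 .$$ Moreover $$\liminf_{k\to\infty}\; k^2\sqrt{\log k}\;\mathbb E[F(x^k)-F^\star]=0,$$ that is, $\mathbb E[F(x^k)]-F^\star=\underline o\big(1/(k^2\sqrt{\log k})\big)$, where $u_k=\underline o(v_k)$ means $\liminf_{k\to\infty}u_k/v_k=0$. -/

import Mathlib

open MeasureTheory ProbabilityTheory Filter Topology
open scoped BigOperators

noncomputable section

namespace RandPD

/-! ### Extended-real-valued convex functions -/

section ConvexBasics

variable {E : Type*} [NormedAddCommGroup E] [InnerProductSpace ℝ E]

/-- The (effective) domain of an extended-real-valued function. -/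
def edom (φ : E → EReal) : Set E := {x | φ x < ⊤}

/-- Proper: finite somewhere and never `-∞`. -/
def EProper (φ : E → EReal) : Prop := (∃ x, φ x < ⊤) ∧ ∀ x, φ x ≠ ⊥

/-- Convexity of a function with values in `ℝ ∪ {+∞}`. -/
def EConvex (φ : E → EReal) : Prop :=
  ∀ x y : E, ∀ a b : ℝ, 0 < a → 0 < b → a + b = 1 →
    φ (a • x + b • y) ≤ (a : EReal) * φ x + (b : EReal) * φ y

/-- `φ` is strongly convex with parameter `μ`: `φ - (μ/2)‖·‖²` is convex. -/
def EStrongConvex (μ : ℝ) (φ : E → EReal) : Prop :=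
  EConvex fun x => φ x - ((μ / 2 * ‖x‖ ^ 2 : ℝ) : EReal)

/-- The Fenchel conjugate. -/
def econj (φ : E → EReal) (y : E) : EReal := ⨆ x, ((inner ℝ y x : ℝ) : EReal) - φ x

/-- `u` minimizes `v ↦ φ v + (1/2)‖v - x‖²`. -/
def IsProx (φ : E → EReal) (x u : E) : Prop :=
  ∀ v, φ u + ((‖u - x‖ ^ 2 / 2 : ℝ) : EReal) ≤ φ v + ((‖v - x‖ ^ 2 / 2 : ℝ) : EReal)

/-- The proximal operator: the minimizer of `v ↦ φ v + (1/2)‖v - x‖²`, which exists and is unique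
when `φ` is proper, closed and convex. -/
def prox (φ : E → EReal) (x : E) : E := Classical.epsilon (IsProx φ x)

/-- `φ` is `M`-Lipschitz continuous at the points of `S` (in particular it is finite there, if it
is proper). For `S = Set.univ` this is Lipschitz continuity on the whole space; it also holds if
`S ⊆ edom φ` and `φ` is `M`-Lipschitz on `edom φ`. -/
def LipschitzAt (M : ℝ) (φ : E → EReal) (S : Set E) : Prop :=
  ∀ u ∈ S, ∀ v, φ u ≤ φ v + ((M * ‖u - v‖ : ℝ) : EReal)

end ConvexBasics

/-! ### The composite problem in block form -/

/-- `ℝ^{s_1} × ⋯ × ℝ^{s_N}` with the Euclidean norm. -/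
abbrev Block {N : ℕ} (s : Fin N → ℕ) : Type := PiLp 2 fun j => EuclideanSpace ℝ (Fin (s j))

/-- The inclusion `U_j` of the `j`-th block. -/
def blockIncl {N : ℕ} {s : Fin N → ℕ} (j : Fin N) (v : EuclideanSpace ℝ (Fin (s j))) : Block s :=
  WithLp.toLp 2 (Pi.single j v)

/-- Replace the `j`-th block of `x` by `v`. -/
def setBlock {N : ℕ} {s : Fin N → ℕ} (x : Block s) (j : Fin N)
    (v : EuclideanSpace ℝ (Fin (s j))) : Block s :=
  WithLp.toLp 2 (Function.update (WithLp.ofLp x) j v)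

/-- The squared weighted norm `∑_j w_j ‖x_j‖²`. -/
def wnormSq {N : ℕ} {s : Fin N → ℕ} (w : Fin N → ℝ) (x : Block s) : ℝ :=
  ∑ j, w j * ‖x j‖ ^ 2

/-- The linear map multiplying the `j`-th block by `a j`. -/
def blockDiag {N : ℕ} (s : Fin N → ℕ) (a : Fin N → ℝ) : Block s →L[ℝ] Block s :=
  LinearMap.toContinuousLinearMap
    { toFun := fun x => WithLp.toLp 2 fun j => a j • x j
      map_add' := fun x y => by ext j l; simp
      map_smul' := fun t x => by ext j l; simp [mul_left_comm] }

/-- The data of `min_x f(x) + h(x) + g(Kx)` with block separable `f` and `g`. -/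
structure Problem {m n : ℕ} (p : Fin n → ℕ) (d : Fin m → ℕ) where
  /-- the components of `f` -/
  f : ∀ j : Fin n, EuclideanSpace ℝ (Fin (p j)) → EReal
  /-- the components of `g` -/
  g : ∀ i : Fin m, EuclideanSpace ℝ (Fin (d i)) → EReal
  /-- the smooth term -/
  h : Block p → ℝ
  /-- the coupling matrix -/
  K : Block p →L[ℝ] Block d

namespace Problem

variable {m n : ℕ} {p : Fin n → ℕ} {d : Fin m → ℕ} (Pb : Problem p d)

/-- `f(x) = ∑_j f_j(x_j)`. -/
def fSum (x : Block p) : EReal := ∑ j, Pb.f j (x j)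

/-- `g(r) = ∑_i g_i(r_i)`. -/
def gSum (r : Block d) : EReal := ∑ i, Pb.g i (r i)

/-- `φ = f + h`. -/
def phi (x : Block p) : EReal := Pb.fSum x + (Pb.h x : EReal)

/-- The primal objective `F(x) = f(x) + h(x) + g(Kx)`. -/
def F (x : Block p) : EReal := Pb.phi x + Pb.gSum (Pb.K x)

/-- The dual objective `G(y) = φ*(-Kᵀy) + g*(y)`. -/
def G (y : Block d) : EReal :=
  econj Pb.phi (-(ContinuousLinearMap.adjoint Pb.K y)) + econj Pb.gSum y

/-- The primal optimal value `F⋆`. -/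
def Fstar : EReal := ⨅ x, Pb.F x

/-- The primal solution set. -/
def primalSol : Set (Block p) := {x | ∀ z, Pb.F x ≤ Pb.F z}

/-- The dual solution set. -/
def dualSol : Set (Block d) := {y | ∀ z, Pb.G y ≤ Pb.G z}

/-- The standing assumptions on the problem; `Lh j` is the smoothness constant of `h` with respect
to the `j`-th block. -/
structure Standing (Lh : Fin n → ℝ) : Prop where
  f_proper : EProper Pb.fSum
  f_closed : LowerSemicontinuous Pb.fSum
  f_convex : EConvex Pb.fSum
  g_proper : EProper Pb.gSum
  g_closed : LowerSemicontinuous Pb.gSum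
  g_convex : EConvex Pb.gSum
  h_convex : ConvexOn ℝ Set.univ Pb.h
  h_diff : Differentiable ℝ Pb.h
  Lh_nonneg : ∀ j, 0 ≤ Lh j
  h_smooth : ∀ (j : Fin n) (x : Block p) (v : EuclideanSpace ℝ (Fin (p j))),
    ‖gradient Pb.h (x + blockIncl j v) j - gradient Pb.h x j‖ ≤ Lh j * ‖v‖
  sol_nonempty : Pb.primalSol.Nonempty
  slater : (0 : Block d) ∈
    intrinsicInterior ℝ {z | ∃ r ∈ edom Pb.gSum, ∃ x ∈ edom Pb.phi, z = r - Pb.K x}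

/-- `L̄_σ = ‖K diag(1/√σ)‖²`. -/
def Lbar (σ : Fin n → ℝ) : ℝ := ‖Pb.K.comp (blockDiag p fun j => 1 / √(σ j))‖ ^ 2

end Problem

/-- `L^h_σ = max_j L^h_j / σ_j`. -/
def LhSigma {n : ℕ} (σ Lh : Fin n → ℝ) : ℝ := ⨆ j, Lh j / σ j

/-- `μ^f_σ = min_j μ_{f_j} / σ_j`. -/
def muSigma {n : ℕ} (σ μf : Fin n → ℝ) : ℝ := ⨅ j, μf j / σ j

/-- `μ_g = min_i μ_{g_i}`. -/
def muMin {m : ℕ} (μg : Fin m → ℝ) : ℝ := ⨅ i, μg i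

/-- `τ_0 = min {min_i q̂_i, min_j q_j}`. -/
def tauZero {m n : ℕ} (qhat : Fin m → ℝ) (q : Fin n → ℝ) : ℝ := min (⨅ i, qhat i) (⨅ j, q j)

/-! ### The fully randomized primal-dual algorithm -/

/-- The parameter sequences of the algorithm. -/
structure Params where
  τ : ℕ → ℝ
  ρ : ℕ → ℝ
  γ : ℕ → ℝ
  β : ℕ → ℝ
  η : ℕ → ℝ

/-- The parameter update `τ_k = cτ₀/(k+c)`, `ρ_k = ρ₀τ₀²/τ_k²`, `γ_k = 1/(4ρ_k)`,
`β_k = 1/(L^h_σ + 4 L̄_σ ρ_k)`, `η_k = ρ_k/2`. -/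
def strongParams (c τ₀ ρ₀ Lhσ Lbarσ : ℝ) : Params :=
  let τ : ℕ → ℝ := fun k => c * τ₀ / (k + c)
  let ρ : ℕ → ℝ := fun k => ρ₀ * τ₀ ^ 2 / τ k ^ 2
  { τ := τ
    ρ := ρ
    γ := fun k => 1 / (4 * ρ k)
    β := fun k => 1 / (Lhσ + 4 * Lbarσ * ρ k)
    η := fun k => ρ k / 2 }

/-- The state `(x^k, x̃^k, r^k, r̃^k, ŷ^k, ȳ^k)` of the algorithm. -/
structure State {m n : ℕ} (p : Fin n → ℕ) (d : Fin m → ℕ) where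
  x : Block p
  xt : Block p
  r : Block d
  rt : Block d
  yhat : Block d
  ybar : Block d

namespace Problem

variable {m n : ℕ} {p : Fin n → ℕ} {d : Fin m → ℕ} (Pb : Problem p d)

/-- One iteration of the algorithm with parameters `τ = τ_k`, …, when the indices `i = i_k` and
`j = j_k` are drawn. -/
def step (σ : Fin n → ℝ) (τ₀ τ ρ γ β η : ℝ) (i : Fin m) (j : Fin n) (s : State p d) :
    State p d :=
  let rhat : Block d := (1 - τ) • s.r + τ • s.rt
  let xhat : Block p := (1 - τ) • s.x + τ • s.xt
  let Δr : EuclideanSpace ℝ (Fin (d i)) := -(s.yhat i) + ρ • (rhat i - Pb.K xhat i)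
  let Δx : EuclideanSpace ℝ (Fin (p j)) := gradient Pb.h xhat j +
    (ContinuousLinearMap.adjoint Pb.K (s.yhat + ρ • (Pb.K xhat - rhat))) j
  let rt' : Block d := setBlock s.rt i
    (prox (fun u => ((γ * τ₀ / τ : ℝ) : EReal) * Pb.g i u) (s.rt i - (τ₀ * γ / τ) • Δr))
  let xt' : Block p := setBlock s.xt j
    (prox (fun u => ((τ₀ * β / (τ * σ j) : ℝ) : EReal) * Pb.f j u)
      (s.xt j - (τ₀ * β / (τ * σ j)) • Δx))
  let r' : Block d := rhat + (τ / τ₀) • (rt' - s.rt)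
  let x' : Block p := xhat + (τ / τ₀) • (xt' - s.xt)
  { x := x'
    xt := xt'
    r := r'
    rt := rt'
    yhat := s.yhat + η • (Pb.K x' - r' - (1 - τ) • (Pb.K s.x - s.r))
    ybar := (1 - τ) • s.ybar + τ • (s.yhat + ρ • (Pb.K xhat - rhat)) }

/-- The `k`-th state of the algorithm started at `(x^0, ŷ^0)` when the sequence of drawn indices
is `idx`. -/
def run (σ : Fin n → ℝ) (τ₀ : ℝ) (π : Params) (x₀ : Block p) (y₀ : Block d)
    (idx : ℕ → Fin m × Fin n) : ℕ → State p d
  | 0 => { x := x₀, xt := x₀, r := Pb.K x₀, rt := Pb.K x₀, yhat := y₀, ybar := y₀ }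
  | k + 1 => Pb.step σ τ₀ (π.τ k) (π.ρ k) (π.γ k) (π.β k) (π.η k) (idx k).1 (idx k).2
      (run σ τ₀ π x₀ y₀ idx k)

/-- The constant `Ê₀²` of the convergence rate. -/
def E0sq (σ Lh μf : Fin n → ℝ) (μg : Fin m → ℝ) (qhat : Fin m → ℝ) (q : Fin n → ℝ) (ρ₀ : ℝ)
    (x₀ xs : Block p) (y₀ ys : Block d) : ℝ :=
  ((Pb.F x₀).toReal - Pb.Fstar.toReal) + 1 / ρ₀ * ‖y₀ - ys‖ ^ 2
    + (LhSigma σ Lh + 4 * ρ₀ * Pb.Lbar σ + muSigma σ μf) * tauZero qhat q / 2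
        * wnormSq (fun j => σ j / q j) (x₀ - xs)
    + tauZero qhat q * (4 * ρ₀ + muMin μg) / 2
        * wnormSq (fun i => 1 / qhat i) (Pb.K (x₀ - xs))

end Problem

/-- The random indices of the algorithm: `i_k ∼ q̂`, `j_k ∼ q`, `i_k` and `j_k` independent, and
the pairs `(i_k, j_k)`, `k = 0, 1, …`, independent of each other. -/
structure IsSampling {Ω : Type*} [MeasurableSpace Ω] (P : Measure Ω) {m n : ℕ}
    (qhat : Fin m → ℝ) (q : Fin n → ℝ) (I : ℕ → Ω → Fin m) (J : ℕ → Ω → Fin n) : Prop where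
  meas_i : ∀ k, Measurable (I k)
  meas_j : ∀ k, Measurable (J k)
  law_i : ∀ k a, P.real {ω | I k ω = a} = qhat a
  law_j : ∀ k b, P.real {ω | J k ω = b} = q b
  indep_pair : ∀ k, IndepFun (I k) (J k) P
  indep_time : iIndepFun (fun k ω => (I k ω, J k ω)) P

/-- `u_k = o̲(v_k)`, i.e. `liminf_k u_k / v_k = 0` (the liminf is taken in `[-∞, ∞]`). -/
def SmallOLiminf (u v : ℕ → ℝ) : Prop :=
  liminf (fun k => ((u k / v k : ℝ) : EReal)) atTop = 0

end RandPD

end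

/-!
The relative interior condition provides multipliers: the minimizers `y⋆` of `G` satisfy
`F⋆ ≤ f x + h x + g r + ⟪y⋆, K x - r⟫` for all `x` and `r`, so the primal-dual gap is nonnegative.
At scale `θ_k = (k + c) / c`, consider the sum of `θ²` times the augmented Lagrangian gap, of
`‖ŷ - y⋆‖² / ρ₀`, and of weighted squared distances of `x̃` and `r̃` to `x⋆` and `K x⋆`. In the gap,
`f (x) + g (r)` is replaced by a running average of the values at `x̃` and `r̃`, which bounds it by
Jensen's inequality and, unlike it, splits along the blocks. A proximal step on a random block then
makes the expected progress of a full step, and strong convexity of `f` and `g` absorbs the growth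
of the weights, so the expected Lyapunov function is nonincreasing.

Hence the expected gap `e_k` is `O(1 / k²)`, and `c τ₀ > 2` leaves a surplus making `∑ k e_k`
finite. As `‖K x - r‖²` is at most `2 / ρ` times the gap, the Lipschitz property of `g` turns `e_k`
into a bound `e_k + O(√e_k / k)` on the expected objective gap. The liminf vanishes because
`∑ 1 / (k log k)` diverges.
-/

namespace RandPD

section ExtendedReal

variable {E : Type*} {φ : E → EReal}

lemma coe_toReal_of_mem_edom (hb : ∀ x, φ x ≠ ⊥) {x : E} (hx : x ∈ edom φ) :
    ((φ x).toReal : EReal) = φ x :=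
  EReal.coe_toReal hx.ne (hb x)

lemma toReal_le_toReal_of_mem_edom (hb : ∀ x, φ x ≠ ⊥) {u v : E} (huv : φ u ≤ φ v)
    (hv : v ∈ edom φ) : (φ u).toReal ≤ (φ v).toReal :=
  EReal.toReal_le_toReal huv (hb u) hv.ne

lemma sub_coe_lt_top_iff {a : EReal} {t : ℝ} : a - (t : EReal) < ⊤ ↔ a < ⊤ := by
  induction a <;> simp [← EReal.coe_sub, EReal.coe_lt_top]

lemma sub_coe_ne_bot_iff {a : EReal} {t : ℝ} : a - (t : EReal) ≠ ⊥ ↔ a ≠ ⊥ := by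
  induction a <;> simp [← EReal.coe_sub]

end ExtendedReal

section Prox

variable {E : Type*} [NormedAddCommGroup E] {φ : E → EReal} {ε : ℝ}

lemma IsProx.mem_edom (hp : EProper φ) (hε : 0 < ε) {x u : E}
    (hu : IsProx (fun v => (ε : EReal) * φ v) x u) : u ∈ edom φ := by
  obtain ⟨⟨v, hv⟩, hb⟩ := hp
  by_contra hud
  have h := hu v
  beta_reduce at h
  rw [show φ u = ⊤ from not_lt_top_iff.1 hud, EReal.coe_mul_top_of_pos hε, EReal.top_add_coe,
    ← coe_toReal_of_mem_edom hb hv, ← EReal.coe_mul, ← EReal.coe_add] at h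
  exact (EReal.coe_lt_top _).not_ge h

lemma IsProx.isMinOn (hb : ∀ x, φ x ≠ ⊥) {x u : E} (hud : u ∈ edom φ)
    (hu : IsProx (fun v => (ε : EReal) * φ v) x u) :
    IsMinOn (fun v => ε * (φ v).toReal + ‖v - x‖ ^ 2 / 2) (edom φ) u := by
  intro v hv
  have h := hu v
  beta_reduce at h
  rw [← coe_toReal_of_mem_edom hb hud, ← coe_toReal_of_mem_edom hb hv] at h
  exact_mod_cast h

end Prox

section ConvexFunctions

variable {E : Type*} [NormedAddCommGroup E] [InnerProductSpace ℝ E] {φ : E → EReal} {μ ε : ℝ}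

lemma EConvex.convexOn (hb : ∀ x, φ x ≠ ⊥) (hφ : EConvex φ) :
    ConvexOn ℝ (edom φ) fun x => (φ x).toReal := by
  have hle : ∀ ⦃x⦄, x ∈ edom φ → ∀ ⦃y⦄, y ∈ edom φ → ∀ ⦃a b : ℝ⦄, 0 < a → 0 < b → a + b = 1 →
      φ (a • x + b • y) ≤ ((a * (φ x).toReal + b * (φ y).toReal : ℝ) : EReal) := by
    intro x hx y hy a b ha hb' hab
    push_cast
    rw [coe_toReal_of_mem_edom hb hx, coe_toReal_of_mem_edom hb hy]
    exact hφ x y a b ha hb' hab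
  refine convexOn_iff_forall_pos.2 ⟨convex_iff_forall_pos.2 fun x hx y hy a b ha hb' hab =>
    (hle hx hy ha hb' hab).trans_lt (EReal.coe_lt_top _), fun x hx y hy a b ha hb' hab => ?_⟩
  exact (EReal.toReal_le_toReal (hle hx hy ha hb' hab) (hb _) (EReal.coe_ne_top _)).trans_eq
    (EReal.toReal_coe _)

lemma EStrongConvex.strongConvexOn (hb : ∀ x, φ x ≠ ⊥) (hφ : EStrongConvex μ φ) :
    StrongConvexOn (edom φ) μ fun x => (φ x).toReal := by
  have hconv := EConvex.convexOn (fun x => sub_coe_ne_bot_iff.2 (hb x)) hφ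
  have hdom : edom (fun x => φ x - ((μ / 2 * ‖x‖ ^ 2 : ℝ) : EReal)) = edom φ :=
    Set.ext fun x => sub_coe_lt_top_iff
  rw [hdom] at hconv
  refine strongConvexOn_iff_convex.2 (hconv.congr fun x hx => ?_)
  beta_reduce
  rw [EReal.toReal_sub hx.ne (hb x) (EReal.coe_ne_top _) (EReal.coe_ne_bot _), EReal.toReal_coe]

lemma strongConvexOn_le_segment {s : Set E} {f : E → ℝ} (hf : StrongConvexOn s μ f)
    {u v : E} (hu : u ∈ s) (hv : v ∈ s) {t : ℝ} (ht : t ∈ Set.Icc (0 : ℝ) 1) :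
    f (u + t • (v - u)) ≤ (1 - t) * f u + t * f v - t * (1 - t) * (μ / 2 * ‖v - u‖ ^ 2) := by
  have h := hf.2 hu hv (sub_nonneg.2 ht.2) ht.1 (sub_add_cancel 1 t)
  rw [show (1 - t) • u + t • v = u + t • (v - u) by module, norm_sub_rev u v, smul_eq_mul,
    smul_eq_mul] at h
  linarith

lemma add_sq_le_of_isMinOn_of_strongConvexOn {s : Set E} {f : E → ℝ} (hf : StrongConvexOn s μ f)
    {u v : E} (hmin : IsMinOn f s u) (hu : u ∈ s) (hv : v ∈ s) :
    f u + μ / 2 * ‖v - u‖ ^ 2 ≤ f v := by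
  have hsegment : ∀ t ∈ Set.Ioo (0 : ℝ) 1, (1 - t) * (μ / 2 * ‖v - u‖ ^ 2) ≤ f v - f u := by
    intro t ht
    have hle := strongConvexOn_le_segment hf hu hv (Set.Ioo_subset_Icc_self ht)
    have hge : f u ≤ f (u + t • (v - u)) :=
      hmin (hf.1.add_smul_sub_mem hu hv (Set.Ioo_subset_Icc_self ht))
    refine le_of_mul_le_mul_left ?_ ht.1
    linarith
  have hlim : Tendsto (fun t : ℝ => (1 - t) * (μ / 2 * ‖v - u‖ ^ 2)) (𝓝[>] 0)
      (𝓝 ((1 - 0) * (μ / 2 * ‖v - u‖ ^ 2))) :=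
    (Continuous.tendsto (by fun_prop) 0).mono_left nhdsWithin_le_nhds
  have hle := le_of_tendsto hlim
    (eventually_of_mem (Ioo_mem_nhdsGT (zero_lt_one' ℝ)) hsegment)
  linarith

lemma strongConvexOn_const_mul_add_half_sq {s : Set E} {f : E → ℝ} (hf : StrongConvexOn s μ f)
    (hε : 0 ≤ ε) (x : E) : StrongConvexOn s (ε * μ + 1) fun v => ε * f v + ‖v - x‖ ^ 2 / 2 := by
  have hlin : ConvexOn ℝ s fun v : E => -inner ℝ x v :=
    ((innerSL ℝ x).toLinearMap.concaveOn hf.1).neg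
  refine strongConvexOn_iff_convex.2 ((((strongConvexOn_iff_convex.1 hf).smul hε).add
    (hlin.add_const (‖x‖ ^ 2 / 2))).congr fun v _ => ?_)
  simp only [smul_eq_mul, Pi.add_apply, norm_sub_sq_real, real_inner_comm x v]
  ring

lemma IsProx.three_point_le (hp : EProper φ) (hs : EStrongConvex μ φ) (hε : 0 < ε) {w Δ u v : E}
    (hu : IsProx (fun v => (ε : EReal) * φ v) (w - ε • Δ) u) (hv : v ∈ edom φ) :
    (φ u).toReal + inner ℝ Δ (u - v) + μ / 2 * ‖v - u‖ ^ 2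
      + 1 / (2 * ε) * (‖u - w‖ ^ 2 + ‖v - u‖ ^ 2 - ‖v - w‖ ^ 2) ≤ (φ v).toReal := by
  have hud := hu.mem_edom hp hε
  have hmin := add_sq_le_of_isMinOn_of_strongConvexOn
    (strongConvexOn_const_mul_add_half_sq (hs.strongConvexOn hp.2) hε.le (w - ε • Δ))
    (hu.isMinOn hp.2 hud) hud hv
  have hexpand (z : E) : ‖z - (w - ε • Δ)‖ ^ 2
      = ‖z - w‖ ^ 2 + 2 * ε * inner ℝ Δ (z - w) + ε ^ 2 * ‖Δ‖ ^ 2 := by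
    rw [show z - (w - ε • Δ) = (z - w) + ε • Δ by abel, norm_add_sq_real, inner_smul_right,
      norm_smul, mul_pow, Real.norm_eq_abs, sq_abs, real_inner_comm]
    ring
  have hinner : inner ℝ Δ (u - v) = inner ℝ Δ (u - w) - inner ℝ Δ (v - w) := by
    rw [← inner_sub_right, sub_sub_sub_cancel_right]
  rw [hexpand, hexpand] at hmin
  refine le_of_mul_le_mul_left ?_ hε
  rw [hinner, mul_add, ← mul_assoc ε, show ε * (1 / (2 * ε)) = 1 / 2 by field_simp]
  linarith

end ConvexFunctions

section ProxExistence

variable {E : Type*} [NormedAddCommGroup E] [InnerProductSpace ℝ E] [ProperSpace E]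
  {φ : E → EReal} {μ ε : ℝ}

/-- On the unit sphere around `v₀` the values are bounded below, and strong convexity propagates
this to quadratic growth along every ray. -/
lemma exists_radius_toReal_le_of_strongConvexOn (hb : ∀ x, φ x ≠ ⊥) (hl : LowerSemicontinuous φ)
    (hμ : 0 < μ) (hs : StrongConvexOn (edom φ) μ fun x => (φ x).toReal) {v₀ : E}
    (hv₀ : v₀ ∈ edom φ) :
    ∃ R : ℝ, 0 < R ∧ ∀ v ∈ edom φ, R ≤ ‖v - v₀‖ → (φ v₀).toReal ≤ (φ v).toReal := by
  obtain ⟨b, -, hbmin⟩ := (hl.lowerSemicontinuousOn _).exists_isMinOn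
    (Metric.nonempty_closedBall.2 zero_le_one : (Metric.closedBall v₀ 1).Nonempty)
    (isCompact_closedBall v₀ 1)
  set C := (φ v₀).toReal - (φ b).toReal
  have hC0 : 0 ≤ C := sub_nonneg.2 (toReal_le_toReal_of_mem_edom hb
    (hbmin (Metric.mem_closedBall_self zero_le_one)) hv₀)
  refine ⟨1 + 2 * C / μ, by positivity, fun v hv hR => ?_⟩
  set s := ‖v - v₀‖ with hs_def
  have hs1 : 1 ≤ s := (le_add_of_nonneg_right (by positivity)).trans hR
  have hs0 : 0 < s := zero_lt_one.trans_le hs1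
  have ht : 1 / s ∈ Set.Icc (0 : ℝ) 1 := ⟨by positivity, (div_le_one hs0).2 hs1⟩
  have hball : v₀ + (1 / s) • (v - v₀) ∈ Metric.closedBall v₀ 1 := by
    rw [Metric.mem_closedBall, dist_eq_norm, add_sub_cancel_left, norm_smul, ← hs_def,
      Real.norm_of_nonneg ht.1, one_div_mul_cancel hs0.ne']
  have hlow := toReal_le_toReal_of_mem_edom hb (hbmin hball) (hs.1.add_smul_sub_mem hv₀ hv ht)
  have hseg := mul_le_mul_of_nonneg_left
    (hlow.trans (strongConvexOn_le_segment hs hv₀ hv ht)) hs0.le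
  rw [← hs_def, show s * ((1 - 1 / s) * (φ v₀).toReal + 1 / s * (φ v).toReal
      - 1 / s * (1 - 1 / s) * (μ / 2 * s ^ 2))
    = (s - 1) * (φ v₀).toReal + (φ v).toReal - (s - 1) * (μ / 2) * s by field_simp] at hseg
  have hgrowth : 2 * C ≤ (s - 1) * μ := (div_le_iff₀ hμ).1 (by linarith)
  nlinarith

lemma continuous_coe_mul (hε : 0 < ε) : Continuous fun y : EReal => (ε : EReal) * y := by
  have hε0 : (ε : EReal) ≠ 0 := mod_cast hε.ne'
  refine continuous_iff_continuousAt.2 fun y => ?_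
  exact (EReal.continuousAt_mul (p := ((ε : EReal), y)) (.inl hε0) (.inl hε0)
    (.inl (EReal.coe_ne_bot _)) (.inl (EReal.coe_ne_top _))).comp
    (f := fun y : EReal => ((ε : EReal), y)) (by fun_prop)

lemma lowerSemicontinuous_coe_mul_add_half_sq {E : Type*} [NormedAddCommGroup E] {φ : E → EReal}
    (hl : LowerSemicontinuous φ) (hε : 0 < ε) (x : E) :
    LowerSemicontinuous fun v => (ε : EReal) * φ v + ((‖v - x‖ ^ 2 / 2 : ℝ) : EReal) := by
  have hmono : Monotone fun y : EReal => (ε : EReal) * y := fun a b hab =>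
    mul_le_mul_of_nonneg_left hab (EReal.coe_nonneg.2 hε.le)
  exact ((continuous_coe_mul hε).comp_lowerSemicontinuous hl hmono).add'
    (continuous_coe_real_ereal.comp (by fun_prop)).lowerSemicontinuous fun v =>
      EReal.continuousAt_add (.inr (EReal.coe_ne_bot _)) (.inr (EReal.coe_ne_top _))

lemma exists_isProx (hp : EProper φ) (hl : LowerSemicontinuous φ) (hμ : 0 < μ)
    (hs : EStrongConvex μ φ) (hε : 0 < ε) (x : E) :
    ∃ u, IsProx (fun v => (ε : EReal) * φ v) x u := by
  obtain ⟨⟨v₀, hv₀⟩, hb⟩ := hp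
  obtain ⟨R, hR, hfar⟩ :=
    exists_radius_toReal_le_of_strongConvexOn hb hl hμ (hs.strongConvexOn hb) hv₀
  set R' := max R (2 * ‖v₀ - x‖)
  have hR' : 0 ≤ R' := hR.le.trans (le_max_left _ _)
  obtain ⟨u, -, humin⟩ := ((lowerSemicontinuous_coe_mul_add_half_sq hl hε x).lowerSemicontinuousOn
    _).exists_isMinOn (Metric.nonempty_closedBall.2 hR' : (Metric.closedBall v₀ R').Nonempty)
    (isCompact_closedBall v₀ R')
  refine ⟨u, fun v => ?_⟩
  by_cases hvR : v ∈ Metric.closedBall v₀ R'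
  · exact humin hvR
  rw [Metric.mem_closedBall, dist_eq_norm, not_le] at hvR
  refine (humin (Metric.mem_closedBall_self hR')).trans ?_
  beta_reduce
  by_cases hv : v ∈ edom φ
  · have hφ := hfar v hv ((le_max_left _ _).trans hvR.le)
    have hdist : ‖v₀ - x‖ ≤ ‖v - x‖ := by
      have htri := norm_sub_le (v - x) (v₀ - x)
      rw [sub_sub_sub_cancel_right] at htri
      linarith [(le_max_right R _).trans hvR.le]
    rw [← coe_toReal_of_mem_edom hb hv, ← coe_toReal_of_mem_edom hb hv₀]
    norm_cast
    gcongr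
  · rw [show φ v = ⊤ from not_lt_top_iff.1 hv, EReal.coe_mul_top_of_pos hε, EReal.top_add_coe]
    exact le_top

lemma isProx_prox (hp : EProper φ) (hl : LowerSemicontinuous φ) (hμ : 0 < μ)
    (hs : EStrongConvex μ φ) (hε : 0 < ε) (x : E) :
    IsProx (fun v => (ε : EReal) * φ v) x (prox (fun v => (ε : EReal) * φ v) x) :=
  Classical.epsilon_spec (exists_isProx hp hl hμ hs hε x)

end ProxExistence

section Duality

variable {X Y : Type*}

lemma exists_pos_smul_mem_of_zero_mem_intrinsicInterior [NormedAddCommGroup Y] [NormedSpace ℝ Y]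
    {D : Set Y} (h0 : (0 : Y) ∈ intrinsicInterior ℝ D) {z : Y}
    (hz : z ∈ (affineSpan ℝ D).direction) : ∃ t : ℝ, 0 < t ∧ t • z ∈ D := by
  obtain ⟨y, hy, hy0⟩ := mem_intrinsicInterior.1 h0
  have hmem : ∀ t : ℝ, t • z ∈ affineSpan ℝ D := fun t => by
    simpa [hy0] using AffineSubspace.vadd_mem_of_mem_direction
      ((affineSpan ℝ D).direction.smul_mem t hz) y.2
  let ray : ℝ → affineSpan ℝ D := fun t => ⟨t • z, hmem t⟩
  have hray : Continuous ray := Continuous.subtype_mk (by fun_prop) _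
  have hray0 : ray 0 = y := Subtype.ext (by simp [ray, hy0])
  have hev : ∀ᶠ t in 𝓝 (0 : ℝ), ray t ∈ interior ((↑) ⁻¹' D : Set (affineSpan ℝ D)) :=
    hray.continuousAt.eventually_mem (hray0 ▸ isOpen_interior.mem_nhds hy)
  obtain ⟨t, ht, htpos⟩ := ((hev.filter_mono nhdsWithin_le_nhds).and
    (self_mem_nhdsWithin (s := Set.Ioi (0 : ℝ)))).exists
  exact ⟨t, htpos, interior_subset (s := ((↑) ⁻¹' D : Set (affineSpan ℝ D))) ht⟩

lemma eq_zero_or_exists_pos_smul_of_mem_hull [AddCommGroup Y] [Module ℝ Y] {C : Set Y}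
    (hC : Convex ℝ C) {w : Y} (hw : w ∈ PointedCone.hull ℝ C) :
    w = 0 ∨ ∃ t : ℝ, 0 < t ∧ ∃ u ∈ C, t • u = w := by
  have hhull {v : Y} : v ∈ ConvexCone.hull ℝ C ↔ ∃ t : ℝ, 0 < t ∧ ∃ u ∈ C, t • u = v :=
    ConvexCone.mem_hull_of_convex hC
  rw [← hhull]
  induction hw using Submodule.span_induction with
  | mem v hv => exact .inr (ConvexCone.subset_hull hv)
  | zero => exact .inl rfl
  | add v₁ v₂ _ _ h₁ h₂ =>
    rcases h₁ with rfl | h₁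
    · simpa using h₂
    rcases h₂ with rfl | h₂
    · simpa using .inr h₁
    exact .inr (ConvexCone.add_mem _ h₁ h₂)
  | smul a v _ hv =>
    rcases hv with rfl | hv
    · exact .inl (smul_zero a)
    rcases eq_or_lt_of_le a.2 with ha | ha
    · exact .inl (by rw [show a = 0 from Subtype.ext ha.symm, zero_smul])
    · exact .inr (ConvexCone.smul_mem _ ha hv)

variable [NormedAddCommGroup Y] [InnerProductSpace ℝ Y] [FiniteDimensional ℝ Y]

/-- The functional `(z, b) ↦ b`, prescribed on the orthogonal complement of the perturbations, is
extended by the M. Riesz theorem to one that is nonnegative on the cone generated by `C`. -/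
lemma exists_inner_add_snd_nonneg {C : Set (Y × ℝ)} (hC : Convex ℝ C)
    (h0 : (0 : Y) ∈ intrinsicInterior ℝ (Prod.fst '' C)) (hpos : ∀ b, ((0 : Y), b) ∈ C → 0 ≤ b) :
    ∃ y : Y, ∀ w ∈ C, 0 ≤ inner ℝ y w.1 + w.2 := by
  set V := (affineSpan ℝ (Prod.fst '' C)).direction
  have hV {w : Y × ℝ} (hw : w ∈ C) : w.1 ∈ V := by
    simpa using AffineSubspace.vsub_mem_direction
      (subset_affineSpan ℝ _ (Set.mem_image_of_mem Prod.fst hw))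
      (subset_affineSpan ℝ _ (intrinsicInterior_subset h0))
  have hnonneg : ∀ w ∈ PointedCone.hull ℝ C, w.1 ∈ Vᗮ → 0 ≤ w.2 := by
    intro w hw hwV
    obtain rfl | ⟨t, ht, u, hu, rfl⟩ := eq_zero_or_exists_pos_smul_of_mem_hull hC hw
    · exact le_rfl
    have hu0 : u.1 = 0 := Submodule.disjoint_def.1 V.orthogonal_disjoint _ (hV hu)
      ((Submodule.smul_mem_iff _ ht.ne').1 hwV)
    exact smul_nonneg ht.le (hpos _ (by rw [← hu0]; exact hu))
  have hdense (w : Y × ℝ) : ∃ v : Y × ℝ, v.1 ∈ Vᗮ ∧ v + w ∈ PointedCone.hull ℝ C := by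
    obtain ⟨z, hz, z', hz', hw⟩ := V.exists_add_mem_mem_orthogonal w.1
    obtain ⟨t, ht, u, hu, hut⟩ := exists_pos_smul_mem_of_zero_mem_intrinsicInterior h0 hz
    refine ⟨(-z', t⁻¹ * u.2 - w.2), neg_mem hz', ?_⟩
    have hsum : (-z', t⁻¹ * u.2 - w.2) + w = (⟨t⁻¹, (inv_pos.2 ht).le⟩ : NNReal) • u := by
      refine Prod.ext ?_ ?_
      · simp [hw, hut, smul_smul, inv_mul_cancel₀ ht.ne']
      · simp
    rw [hsum]
    exact Submodule.smul_mem _ _ (PointedCone.subset_hull hu)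
  obtain ⟨G, hGV, hGC⟩ := riesz_extension (PointedCone.hull ℝ C)
    ((LinearMap.snd ℝ Y ℝ).toPMap (Vᗮ.prod ⊤)) (fun w hw => hnonneg w hw w.2.1)
    fun w => let ⟨v, hv, hvw⟩ := hdense w; ⟨⟨v, hv, trivial⟩, hvw⟩
  refine ⟨(InnerProductSpace.toDual ℝ Y).symm
    (LinearMap.toContinuousLinearMap (G.comp (LinearMap.inl ℝ Y ℝ))), fun w hw => ?_⟩
  have hsnd : G (0, w.2) = w.2 := hGV ⟨(0, w.2), zero_mem _, trivial⟩
  calc 0 ≤ G w := hGC w (PointedCone.subset_hull hw)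
    _ = G (w.1, 0) + G (0, w.2) := by rw [← map_add]; simp
    _ = _ := by rw [hsnd, InnerProductSpace.toDual_symm_apply]; rfl

lemma exists_multiplier [AddCommGroup X] [Module ℝ X] (K : X →ₗ[ℝ] Y) {A : Set X} {B : Set Y}
    {φ : X → ℝ} {g : Y → ℝ} (hφ : ConvexOn ℝ A φ) (hg : ConvexOn ℝ B g) {Fs : ℝ}
    (hFs : ∀ x ∈ A, K x ∈ B → Fs ≤ φ x + g (K x))
    (h0 : (0 : Y) ∈ intrinsicInterior ℝ {z | ∃ r ∈ B, ∃ x ∈ A, z = r - K x}) :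
    ∃ y : Y, ∀ x ∈ A, ∀ r ∈ B, Fs ≤ φ x + g r + inner ℝ y (K x - r) := by
  let C : Set (Y × ℝ) := {w | ∃ r ∈ B, ∃ x ∈ A, w.1 = r - K x ∧ φ x + g r - Fs ≤ w.2}
  have hC : Convex ℝ C := by
    rintro w ⟨r, hr, x, hx, hw, hle⟩ w' ⟨r', hr', x', hx', hw', hle'⟩ a b ha hb hab
    refine ⟨_, hg.1 hr hr' ha hb hab, _, hφ.1 hx hx' ha hb hab, ?_, ?_⟩
    · simp only [Prod.fst_add, Prod.smul_fst, hw, hw', map_add, map_smul]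
      module
    · have hgc := hg.2 hr hr' ha hb hab
      have hφc := hφ.2 hx hx' ha hb hab
      simp only [smul_eq_mul, Prod.snd_add, Prod.smul_snd] at *
      obtain rfl := eq_sub_of_add_eq hab
      nlinarith
  have hfst : Prod.fst '' C = {z | ∃ r ∈ B, ∃ x ∈ A, z = r - K x} := by
    ext z
    constructor
    · rintro ⟨w, ⟨r, hr, x, hx, hw, -⟩, rfl⟩
      exact ⟨r, hr, x, hx, hw⟩
    · rintro ⟨r, hr, x, hx, rfl⟩
      exact ⟨(r - K x, φ x + g r - Fs), ⟨r, hr, x, hx, rfl, le_rfl⟩, rfl⟩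
  have hpos (b : ℝ) (hb : ((0 : Y), b) ∈ C) : 0 ≤ b := by
    obtain ⟨r, hr, x, hx, hrx, hle⟩ := hb
    obtain rfl := sub_eq_zero.1 hrx.symm
    exact (sub_nonneg.2 (hFs x hx hr)).trans hle
  obtain ⟨y, hy⟩ := exists_inner_add_snd_nonneg hC (hfst ▸ h0) hpos
  refine ⟨-y, fun x hx r hr => ?_⟩
  have hle := hy (r - K x, φ x + g r - Fs) ⟨r, hr, x, hx, rfl, le_rfl⟩
  rw [← neg_sub r (K x), inner_neg_neg]
  linarith

end Duality

section Separable

lemma sum_ereal_ne_bot_iff {ι : Type*} {t : Finset ι} {a : ι → EReal} :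
    ∑ i ∈ t, a i ≠ ⊥ ↔ ∀ i ∈ t, a i ≠ ⊥ := by
  classical
  induction t using Finset.induction_on with
  | empty => simp
  | insert i t hi ih => simp [Finset.sum_insert hi, ih]

lemma coe_ereal_sum {ι : Type*} (t : Finset ι) (a : ι → ℝ) :
    ((∑ i ∈ t, a i : ℝ) : EReal) = ∑ i ∈ t, (a i : EReal) :=
  map_sum (⟨⟨Real.toEReal, EReal.coe_zero⟩, EReal.coe_add⟩ : ℝ →+ EReal) a t

lemma sum_ereal_lt_top_iff {ι : Type*} {t : Finset ι} {a : ι → EReal} (h : ∀ i ∈ t, a i ≠ ⊥) :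
    ∑ i ∈ t, a i < ⊤ ↔ ∀ i ∈ t, a i < ⊤ := by
  classical
  induction t using Finset.induction_on with
  | empty => simp
  | insert i t hi ih =>
    have ht : ∀ j ∈ t, a j ≠ ⊥ := fun j hj => h j (Finset.mem_insert_of_mem hj)
    rw [Finset.sum_insert hi, Finset.forall_mem_insert, ← ih ht, lt_top_iff_ne_top,
      EReal.add_ne_top_iff_ne_top₂ (h i (Finset.mem_insert_self _ _)) (sum_ereal_ne_bot_iff.2 ht)]
    simp only [lt_top_iff_ne_top]

variable {N : ℕ} {s : Fin N → ℕ} {φ : ∀ j, EuclideanSpace ℝ (Fin (s j)) → EReal}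

lemma component_ne_bot (hb : ∀ x : Block s, ∑ j, φ j (x j) ≠ ⊥) (j : Fin N)
    (v : EuclideanSpace ℝ (Fin (s j))) : φ j v ≠ ⊥ := by
  simpa [blockIncl] using sum_ereal_ne_bot_iff.1 (hb (blockIncl j v)) j (Finset.mem_univ j)

lemma mem_edom_sum_iff (hb : ∀ x : Block s, ∑ j, φ j (x j) ≠ ⊥) {x : Block s} :
    x ∈ edom (fun x : Block s => ∑ j, φ j (x j)) ↔ ∀ j, x j ∈ edom (φ j) := by
  simpa [edom] using sum_ereal_lt_top_iff (t := Finset.univ) fun j _ => component_ne_bot hb j (x j)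

lemma component_proper (hp : EProper fun x : Block s => ∑ j, φ j (x j)) (j : Fin N) :
    EProper (φ j) :=
  let ⟨⟨x, hx⟩, hb⟩ := hp
  ⟨⟨x j, (mem_edom_sum_iff hb).1 hx j⟩, component_ne_bot hb j⟩

lemma sum_eq_coe (hb : ∀ x : Block s, ∑ j, φ j (x j) ≠ ⊥) {x : Block s}
    (hx : x ∈ edom fun x : Block s => ∑ j, φ j (x j)) :
    ∑ j, φ j (x j) = ((∑ j, (φ j (x j)).toReal : ℝ) : EReal) := by
  rw [coe_ereal_sum]
  exact Finset.sum_congr rfl fun j _ =>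
    (coe_toReal_of_mem_edom (component_ne_bot hb j) ((mem_edom_sum_iff hb).1 hx j)).symm

lemma component_closed (hp : EProper fun x : Block s => ∑ j, φ j (x j))
    (hl : LowerSemicontinuous fun x : Block s => ∑ j, φ j (x j)) (j : Fin N) :
    LowerSemicontinuous (φ j) := by
  obtain ⟨⟨x, hx⟩, hb⟩ := hp
  set c : ℝ := ∑ i ∈ Finset.univ.erase j, (φ i (x i)).toReal with hc
  have hsum (v) : ∑ i, φ i (setBlock x j v i) = φ j v + (c : EReal) := by
    rw [← Finset.add_sum_erase _ _ (Finset.mem_univ j), hc, coe_ereal_sum]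
    refine congrArg₂ _ (by simp [setBlock]) (Finset.sum_congr rfl fun i hi => ?_)
    rw [coe_toReal_of_mem_edom (component_ne_bot hb i) ((mem_edom_sum_iff hb).1 hx i)]
    simp [setBlock, Function.update_of_ne (Finset.ne_of_mem_erase hi)]
  have heq : φ j = fun v => (∑ i, φ i (setBlock x j v i)) + ((-c : ℝ) : EReal) := by
    funext v
    rw [hsum, add_assoc, ← EReal.coe_add, add_neg_cancel, EReal.coe_zero, add_zero]
  have hcont : Continuous fun v : EuclideanSpace ℝ (Fin (s j)) => setBlock x j v := by
    unfold setBlock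
    fun_prop
  rw [heq]
  exact (hl.comp hcont).add' (g := fun _ => ((-c : ℝ) : EReal)) lowerSemicontinuous_const
    fun v => EReal.continuousAt_add (.inr (EReal.coe_ne_bot _)) (.inr (EReal.coe_ne_top _))

end Separable

lemma exists_mem_edom_lt_of_lt_econj {E : Type*} [NormedAddCommGroup E] [InnerProductSpace ℝ E]
    {φ : E → EReal} {y : E} {a : EReal} (ha : a < econj φ y) :
    ∃ x ∈ edom φ, a < ((inner ℝ y x : ℝ) : EReal) - φ x := by
  obtain ⟨x, hx⟩ := lt_iSup_iff.1 ha
  refine ⟨x, show φ x < ⊤ from lt_top_iff_ne_top.2 fun htop => ?_, hx⟩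
  rw [htop, EReal.sub_top] at hx
  exact not_lt_bot hx

namespace Problem

variable {m n : ℕ} {p : Fin n → ℕ} {d : Fin m → ℕ} {Pb : Problem p d} {Lh : Fin n → ℝ}

/-- The real value of `f`, meaningful on its domain. -/
def fR (Pb : Problem p d) (x : Block p) : ℝ := ∑ j, (Pb.f j (x j)).toReal

/-- The real value of `g`, meaningful on its domain. -/
def gR (Pb : Problem p d) (r : Block d) : ℝ := ∑ i, (Pb.g i (r i)).toReal

/-- The real value of `F`, meaningful where `x ∈ dom f` and `K x ∈ dom g`. -/
def FR (Pb : Problem p d) (x : Block p) : ℝ := Pb.fR x + Pb.h x + Pb.gR (Pb.K x)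

/-- `y` is a Lagrange multiplier certifying the lower bound `v` for `f(x) + h(x) + g(r)` under the
constraint `K x = r`. -/
def IsMultiplier (Pb : Problem p d) (v : ℝ) (y : Block d) : Prop :=
  ∀ x ∈ edom Pb.fSum, ∀ r ∈ edom Pb.gSum,
    v ≤ Pb.fR x + Pb.h x + Pb.gR r + inner ℝ y (Pb.K x - r)

lemma edom_phi (Pb : Problem p d) : edom Pb.phi = edom Pb.fSum := by
  ext x
  simp [edom, phi, lt_top_iff_ne_top, EReal.add_ne_top_iff_ne_top_left]

namespace Standing

variable (hA : Pb.Standing Lh)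
include hA

lemma fSum_eq {x : Block p} (hx : x ∈ edom Pb.fSum) : Pb.fSum x = (Pb.fR x : EReal) :=
  sum_eq_coe hA.f_proper.2 hx

lemma gSum_eq {r : Block d} (hr : r ∈ edom Pb.gSum) : Pb.gSum r = (Pb.gR r : EReal) :=
  sum_eq_coe hA.g_proper.2 hr

lemma phi_eq {x : Block p} (hx : x ∈ edom Pb.fSum) :
    Pb.phi x = ((Pb.fR x + Pb.h x : ℝ) : EReal) := by
  rw [phi, hA.fSum_eq hx, EReal.coe_add]

lemma F_eq {x : Block p} (hx : x ∈ edom Pb.fSum) (hr : Pb.K x ∈ edom Pb.gSum) :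
    Pb.F x = (Pb.FR x : EReal) := by
  rw [F, hA.phi_eq hx, hA.gSum_eq hr, FR, ← EReal.coe_add]

lemma fR_convexOn : ConvexOn ℝ (edom Pb.fSum) Pb.fR :=
  (EConvex.convexOn hA.f_proper.2 hA.f_convex).congr fun x hx => by
    beta_reduce
    rw [hA.fSum_eq hx, EReal.toReal_coe]

lemma gR_convexOn : ConvexOn ℝ (edom Pb.gSum) Pb.gR :=
  (EConvex.convexOn hA.g_proper.2 hA.g_convex).congr fun x hx => by
    beta_reduce
    rw [hA.gSum_eq hx, EReal.toReal_coe]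

lemma F_lt_top_iff {x : Block p} :
    Pb.F x < ⊤ ↔ x ∈ edom Pb.fSum ∧ Pb.K x ∈ edom Pb.gSum := by
  have hφ : Pb.phi x ≠ ⊥ := EReal.add_ne_bot_iff.2 ⟨hA.f_proper.2 x, EReal.coe_ne_bot _⟩
  rw [F, lt_top_iff_ne_top, EReal.add_ne_top_iff_ne_top₂ hφ (hA.g_proper.2 _), ← edom_phi]
  simp only [edom, lt_top_iff_ne_top, Set.mem_ofPred_eq]

lemma mem_edom_of_mem_primalSol {xs : Block p} (hxs : xs ∈ Pb.primalSol) :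
    xs ∈ edom Pb.fSum ∧ Pb.K xs ∈ edom Pb.gSum := by
  obtain ⟨r, hr, x, hx, h0⟩ := intrinsicInterior_subset hA.slater
  obtain rfl : r = Pb.K x := sub_eq_zero.1 h0.symm
  rw [edom_phi] at hx
  exact hA.F_lt_top_iff.1 ((hxs x).trans_lt (hA.F_lt_top_iff.2 ⟨hx, hr⟩))

lemma Fstar_eq {xs : Block p} (hxs : xs ∈ Pb.primalSol) : Pb.Fstar = (Pb.FR xs : EReal) := by
  obtain ⟨hf, hg⟩ := hA.mem_edom_of_mem_primalSol hxs
  rw [← hA.F_eq hf hg]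
  exact le_antisymm (iInf_le _ _) (le_iInf hxs)

lemma exists_isMultiplier {xs : Block p} (hxs : xs ∈ Pb.primalSol) :
    ∃ y, Pb.IsMultiplier (Pb.FR xs) y := by
  obtain ⟨hf, hg⟩ := hA.mem_edom_of_mem_primalSol hxs
  have hconv : ConvexOn ℝ (edom Pb.fSum) fun x => Pb.fR x + Pb.h x :=
    hA.fR_convexOn.add (hA.h_convex.subset (Set.subset_univ _) hA.fR_convexOn.1)
  refine exists_multiplier Pb.K.toLinearMap hconv hA.gR_convexOn (fun x hx hr => ?_)
    (edom_phi Pb ▸ hA.slater)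
  have hle := hxs x
  rw [hA.F_eq hf hg, hA.F_eq hx hr] at hle
  exact_mod_cast hle

lemma inner_sub_phi {x : Block p} (hx : x ∈ edom Pb.fSum) (y : Block d) :
    ((inner ℝ (-(ContinuousLinearMap.adjoint Pb.K y)) x : ℝ) : EReal) - Pb.phi x
      = ((-inner ℝ y (Pb.K x) - (Pb.fR x + Pb.h x) : ℝ) : EReal) := by
  rw [hA.phi_eq hx, inner_neg_left, ContinuousLinearMap.adjoint_inner_left, EReal.coe_sub]

lemma inner_sub_gSum {r : Block d} (hr : r ∈ edom Pb.gSum) (y : Block d) :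
    ((inner ℝ y r : ℝ) : EReal) - Pb.gSum r = ((inner ℝ y r - Pb.gR r : ℝ) : EReal) := by
  rw [hA.gSum_eq hr, EReal.coe_sub]

lemma G_le_neg_iff_isMultiplier {v : ℝ} {y : Block d} :
    Pb.G y ≤ ((-v : ℝ) : EReal) ↔ Pb.IsMultiplier v y := by
  have hvalue (x : Block p) (r : Block d) :
      -inner ℝ y (Pb.K x) - (Pb.fR x + Pb.h x) + (inner ℝ y r - Pb.gR r) ≤ -v ↔
        v ≤ Pb.fR x + Pb.h x + Pb.gR r + inner ℝ y (Pb.K x - r) := by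
    rw [inner_sub_right]
    constructor <;> intro h <;> linarith
  constructor
  · intro hG x hx r hr
    have hle := (add_le_add (le_iSup (fun x => ((inner ℝ
      (-(ContinuousLinearMap.adjoint Pb.K y)) x : ℝ) : EReal) - Pb.phi x) x)
      (le_iSup (fun r => ((inner ℝ y r : ℝ) : EReal) - Pb.gSum r) r)).trans hG
    rw [hA.inner_sub_phi hx, hA.inner_sub_gSum hr, ← EReal.coe_add, EReal.coe_le_coe_iff] at hle
    exact (hvalue x r).1 hle
  · refine fun hy => EReal.add_le_of_forall_lt fun a ha b hb => ?_
    obtain ⟨x, hx, hax⟩ := exists_mem_edom_lt_of_lt_econj ha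
    obtain ⟨r, hr, hbr⟩ := exists_mem_edom_lt_of_lt_econj hb
    rw [edom_phi] at hx
    rw [hA.inner_sub_phi hx] at hax
    rw [hA.inner_sub_gSum hr] at hbr
    refine (add_le_add hax.le hbr.le).trans ?_
    rw [← EReal.coe_add, EReal.coe_le_coe_iff]
    exact (hvalue x r).2 (hy x hx r hr)

lemma isMultiplier_of_mem_dualSol {xs : Block p} (hxs : xs ∈ Pb.primalSol) {ys : Block d}
    (hys : ys ∈ Pb.dualSol) : Pb.IsMultiplier (Pb.FR xs) ys := by
  obtain ⟨y, hy⟩ := hA.exists_isMultiplier hxs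
  exact hA.G_le_neg_iff_isMultiplier.1 ((hys y).trans (hA.G_le_neg_iff_isMultiplier.2 hy))

lemma map_mem_edom {M : ℝ} (hLip : LipschitzAt M Pb.gSum (Pb.K '' edom Pb.fSum)) {x : Block p}
    (hx : x ∈ edom Pb.fSum) : Pb.K x ∈ edom Pb.gSum := by
  obtain ⟨r₀, hr₀⟩ := hA.g_proper.1
  refine (hLip _ ⟨x, hx, rfl⟩ r₀).trans_lt ?_
  rw [hA.gSum_eq hr₀, ← EReal.coe_add]
  exact EReal.coe_lt_top _

lemma gR_map_le {M : ℝ} (hLip : LipschitzAt M Pb.gSum (Pb.K '' edom Pb.fSum)) {x : Block p}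
    (hx : x ∈ edom Pb.fSum) {r : Block d} (hr : r ∈ edom Pb.gSum) :
    Pb.gR (Pb.K x) ≤ Pb.gR r + M * ‖Pb.K x - r‖ := by
  have hle := hLip _ ⟨x, hx, rfl⟩ r
  rw [hA.gSum_eq hr, hA.gSum_eq (hA.map_mem_edom hLip hx)] at hle
  exact_mod_cast hle

end Standing

end Problem

section Descent

variable {E : Type*} [NormedAddCommGroup E] [InnerProductSpace ℝ E] [CompleteSpace E] {h : E → ℝ}

lemma hasDerivAt_comp_line (hd : Differentiable ℝ h) (x v : E) (t : ℝ) :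
    HasDerivAt (fun t : ℝ => h (x + t • v)) (inner ℝ (gradient h (x + t • v)) v) t := by
  have hline : HasDerivAt (fun t : ℝ => x + t • v) v t := by
    simpa using ((hasDerivAt_id t).smul_const v).const_add x
  simpa [Function.comp_def] using
    (hd (x + t • v)).hasGradientAt.hasFDerivAt.comp_hasDerivAt t hline

lemma add_inner_gradient_le_of_convexOn (hc : ConvexOn ℝ Set.univ h) (hd : Differentiable ℝ h)
    (x y : E) : h x + inner ℝ (gradient h x) (y - x) ≤ h y := by
  have hconv : ConvexOn ℝ Set.univ fun t : ℝ => h (x + t • (y - x)) := by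
    simpa [Function.comp_def, AffineMap.lineMap_apply, add_comm] using
      hc.comp_affineMap (AffineMap.lineMap (k := ℝ) x y)
  have hslope := hconv.le_slope_of_hasDerivAt (Set.mem_univ 0) (Set.mem_univ 1) one_pos
    (hasDerivAt_comp_line hd x (y - x) 0)
  simp only [zero_smul, add_zero, slope, one_smul, vsub_eq_sub, sub_zero, inv_one,
    add_sub_cancel] at hslope
  linarith

lemma le_add_inner_gradient_of_lipschitz_along (hd : Differentiable ℝ h) {x v : E} {L : ℝ}
    (hL : ∀ t : ℝ, 0 < t → inner ℝ (gradient h (x + t • v) - gradient h x) v ≤ L * t * ‖v‖ ^ 2) :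
    h (x + v) ≤ h x + inner ℝ (gradient h x) v + L / 2 * ‖v‖ ^ 2 := by
  set a : ℝ := inner ℝ (gradient h x) v with ha
  let ψ : ℝ → ℝ := fun t => h (x + t • v) - t * a - t ^ 2 * (L / 2 * ‖v‖ ^ 2)
  have hψ (t : ℝ) : HasDerivAt ψ
      (inner ℝ (gradient h (x + t • v)) v - a - 2 * t * (L / 2 * ‖v‖ ^ 2)) t := by
    have hlinear : HasDerivAt (fun t : ℝ => t * a) a t := by
      simpa using (hasDerivAt_id t).mul_const a
    have hquadratic : HasDerivAt (fun t : ℝ => t ^ 2 * (L / 2 * ‖v‖ ^ 2))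
        (2 * t * (L / 2 * ‖v‖ ^ 2)) t := by
      simpa using (hasDerivAt_pow 2 t).mul_const (L / 2 * ‖v‖ ^ 2)
    exact ((hasDerivAt_comp_line hd x v t).sub hlinear).sub hquadratic
  have hanti : AntitoneOn ψ (Set.Icc 0 1) := by
    refine antitoneOn_of_deriv_nonpos (convex_Icc 0 1)
      (fun t _ => (hψ t).continuousAt.continuousWithinAt)
      (fun t _ => (hψ t).differentiableAt.differentiableWithinAt) fun t ht => ?_
    rw [interior_Icc] at ht
    rw [(hψ t).deriv, ha, ← inner_sub_left]
    linarith [hL t ht.1]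
  have hends := hanti (Set.left_mem_Icc.2 zero_le_one) (Set.right_mem_Icc.2 zero_le_one) zero_le_one
  simp only [ψ, one_smul, zero_smul, add_zero] at hends
  linarith

end Descent

section Blocks

variable {N : ℕ} {s : Fin N → ℕ}

lemma setBlock_sub (x : Block s) (j : Fin N) (v : EuclideanSpace ℝ (Fin (s j))) :
    setBlock x j v - x = blockIncl j (v - x j) := by
  ext i l
  by_cases h : i = j
  · subst h
    simp [setBlock, blockIncl]
  · simp [setBlock, blockIncl, Function.update_of_ne h, Pi.single_eq_of_ne h]

lemma smul_blockIncl (t : ℝ) (j : Fin N) (v : EuclideanSpace ℝ (Fin (s j))) :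
    t • (blockIncl j v : Block s) = blockIncl j (t • v) := by
  rw [blockIncl, blockIncl, Pi.single_smul, WithLp.toLp_smul]

lemma inner_blockIncl (x : Block s) (j : Fin N) (v : EuclideanSpace ℝ (Fin (s j))) :
    inner ℝ x (blockIncl j v) = inner ℝ (x j) v := by
  rw [PiLp.inner_apply, Finset.sum_eq_single j]
  · simp [blockIncl]
  · intro i _ hi
    simp [blockIncl, Pi.single_eq_of_ne hi]
  · simp

lemma norm_blockIncl (j : Fin N) (v : EuclideanSpace ℝ (Fin (s j))) :
    ‖(blockIncl j v : Block s)‖ = ‖v‖ := by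
  rw [← sq_eq_sq₀ (norm_nonneg _) (norm_nonneg _), ← real_inner_self_eq_norm_sq, inner_blockIncl,
    ← real_inner_self_eq_norm_sq]
  simp [blockIncl]

lemma setBlock_same (x : Block s) (j : Fin N) (v : EuclideanSpace ℝ (Fin (s j))) :
    setBlock x j v j = v := by
  simp [setBlock]

lemma setBlock_of_ne (x : Block s) {i j : Fin N} (h : i ≠ j) (v : EuclideanSpace ℝ (Fin (s j))) :
    setBlock x j v i = x i := by
  simp [setBlock, Function.update_of_ne h]

lemma sum_setBlock (φ : ∀ j, EuclideanSpace ℝ (Fin (s j)) → ℝ) (x : Block s) (j : Fin N)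
    (v : EuclideanSpace ℝ (Fin (s j))) :
    ∑ i, φ i (setBlock x j v i) = ∑ i, φ i (x i) + (φ j v - φ j (x j)) := by
  rw [← Finset.add_sum_erase _ _ (Finset.mem_univ j),
    ← Finset.add_sum_erase Finset.univ (fun i => φ i (x i)) (Finset.mem_univ j), setBlock_same,
    Finset.sum_congr rfl fun i hi => by rw [setBlock_of_ne x (Finset.ne_of_mem_erase hi)]]
  ring

lemma wnormSq_setBlock_sub (w : Fin N → ℝ) (x z : Block s) (j : Fin N)
    (v : EuclideanSpace ℝ (Fin (s j))) :
    wnormSq w (setBlock x j v - z)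
      = wnormSq w (x - z) + w j * (‖v - z j‖ ^ 2 - ‖x j - z j‖ ^ 2) := by
  simp only [wnormSq, PiLp.sub_apply]
  rw [sum_setBlock (fun i u => w i * ‖u - z i‖ ^ 2)]
  ring

lemma wnormSq_nonneg {w : Fin N → ℝ} (hw : ∀ j, 0 ≤ w j) (x : Block s) : 0 ≤ wnormSq w x :=
  Finset.sum_nonneg fun j _ => mul_nonneg (hw j) (sq_nonneg _)

lemma setBlock_mem_edom_sum {φ : ∀ j, EuclideanSpace ℝ (Fin (s j)) → EReal}
    (hb : ∀ x : Block s, ∑ j, φ j (x j) ≠ ⊥) {x : Block s}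
    (hx : x ∈ edom fun x : Block s => ∑ j, φ j (x j))
    {j : Fin N} {v : EuclideanSpace ℝ (Fin (s j))} (hv : v ∈ edom (φ j)) :
    setBlock x j v ∈ edom fun x : Block s => ∑ j, φ j (x j) := by
  rw [mem_edom_sum_iff hb] at hx ⊢
  intro i
  by_cases h : i = j
  · subst h
    rwa [setBlock_same]
  · rw [setBlock_of_ne x h]
    exact hx i

lemma block_descent {h : Block s → ℝ} (hd : Differentiable ℝ h) {j : Fin N} {L : ℝ}
    (hL : ∀ (x : Block s) (v : EuclideanSpace ℝ (Fin (s j))),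
      ‖gradient h (x + blockIncl j v) j - gradient h x j‖ ≤ L * ‖v‖)
    (x : Block s) (v : EuclideanSpace ℝ (Fin (s j))) :
    h (x + blockIncl j v) ≤ h x + inner ℝ (gradient h x j) v + L / 2 * ‖v‖ ^ 2 := by
  rw [← inner_blockIncl, ← norm_blockIncl j v]
  refine le_add_inner_gradient_of_lipschitz_along hd fun t ht => ?_
  rw [inner_blockIncl, smul_blockIncl, norm_blockIncl]
  calc _ ≤ ‖gradient h (x + blockIncl j (t • v)) j - gradient h x j‖ * ‖v‖ :=
        real_inner_le_norm _ _
    _ ≤ L * ‖t • v‖ * ‖v‖ := by gcongr; exact hL x (t • v)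
    _ = L * t * ‖v‖ ^ 2 := by rw [norm_smul, Real.norm_of_nonneg ht.le]; ring

lemma blockDiag_blockIncl (a : Fin N → ℝ) (j : Fin N) (v : EuclideanSpace ℝ (Fin (s j))) :
    blockDiag s a (blockIncl j v) = blockIncl j (a j • v) := by
  ext i l
  by_cases h : i = j
  · subst h
    simp [blockDiag, blockIncl]
  · simp [blockDiag, blockIncl, Pi.single_eq_of_ne h]

lemma norm_map_blockIncl_sq_le {m n : ℕ} {p : Fin n → ℕ} {d : Fin m → ℕ} (Pb : Problem p d)
    {σ : Fin n → ℝ} (hσ : ∀ j, 0 < σ j) (j : Fin n) (v : EuclideanSpace ℝ (Fin (p j))) :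
    ‖Pb.K (blockIncl j v)‖ ^ 2 ≤ Pb.Lbar σ * (σ j * ‖v‖ ^ 2) := by
  have hpos : 0 < √(σ j) := Real.sqrt_pos.2 (hσ j)
  have hle := (Pb.K.comp (blockDiag p fun j => 1 / √(σ j))).le_opNorm (blockIncl j (√(σ j) • v))
  rw [ContinuousLinearMap.comp_apply, blockDiag_blockIncl, smul_smul, one_div_mul_cancel hpos.ne',
    one_smul, norm_blockIncl, norm_smul, Real.norm_of_nonneg hpos.le] at hle
  calc _ ≤ _ := pow_le_pow_left₀ (norm_nonneg _) hle 2
    _ = _ := by rw [mul_pow, mul_pow, Real.sq_sqrt (hσ j).le, Problem.Lbar]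

end Blocks

section Constants

variable {N : ℕ} {σ : Fin N → ℝ}

lemma le_LhSigma_mul (hσ : ∀ j, 0 < σ j) (Lh : Fin N → ℝ) (j : Fin N) :
    Lh j ≤ LhSigma σ Lh * σ j :=
  (div_le_iff₀ (hσ j)).1
    (le_ciSup (f := fun j => Lh j / σ j) (Finite.bddAbove_range _) j)

lemma muSigma_mul_le (hσ : ∀ j, 0 < σ j) (μf : Fin N → ℝ) (j : Fin N) :
    muSigma σ μf * σ j ≤ μf j :=
  (le_div_iff₀ (hσ j)).1 (ciInf_le (f := fun j => μf j / σ j) (Finite.bddBelow_range _) j)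

lemma muMin_le (μg : Fin N → ℝ) (i : Fin N) : muMin μg ≤ μg i :=
  ciInf_le (Finite.bddBelow_range _) i

end Constants

lemma IsProx.progress_le {E : Type*} [NormedAddCommGroup E] [InnerProductSpace ℝ E]
    {φ : E → EReal} {a ε μ ν : ℝ} (hp : EProper φ) (hs : EStrongConvex μ φ) (hμ : 0 ≤ μ)
    (hν : ν ≤ μ) (hε : 0 < ε) (ha : 1 ≤ a) {w Δ u v : E}
    (hu : IsProx (fun v => (ε : EReal) * φ v) (w - ε • Δ) u) (hw : w ∈ edom φ) (hv : v ∈ edom φ) :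
    a * ((φ u).toReal - (φ w).toReal + inner ℝ Δ (u - w) + 1 / (2 * ε) * ‖u - w‖ ^ 2)
        + (1 / (2 * ε) + ν / 2) * (‖u - v‖ ^ 2 - ‖w - v‖ ^ 2)
      ≤ (φ v).toReal - (φ w).toReal + inner ℝ Δ (v - w) - ν / 2 * ‖w - v‖ ^ 2 := by
  have hat_v := hu.three_point_le hp hs hε hv
  have hat_w := hu.three_point_le hp hs hε hw
  have hsplit : inner ℝ Δ (u - v) = inner ℝ Δ (u - w) - inner ℝ Δ (v - w) := by
    rw [← inner_sub_right, sub_sub_sub_cancel_right]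
  rw [hsplit, norm_sub_rev v u, norm_sub_rev v w] at hat_v
  rw [norm_sub_rev w u, sub_self, norm_zero] at hat_w
  have hdescent : (φ u).toReal - (φ w).toReal + inner ℝ Δ (u - w) + 1 / (2 * ε) * ‖u - w‖ ^ 2
      ≤ 0 := by
    have hstrong : 0 ≤ μ / 2 * ‖u - w‖ ^ 2 := by positivity
    have hprox : 0 ≤ 1 / (2 * ε) * ‖u - w‖ ^ 2 := by positivity
    linarith
  have hmodulus : ν / 2 * ‖u - v‖ ^ 2 ≤ μ / 2 * ‖u - v‖ ^ 2 := by gcongr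
  linarith [mul_nonneg_of_nonpos_of_nonpos (sub_nonpos.2 ha) hdescent]

section BlockProx

variable {N : ℕ} {s : Fin N → ℕ}

/-- The proximal step on block `j` from `z` in the direction `-Δ`. The coefficients `w` are the
weights of the blocks, `β` is the step size, and `τ₀ / τ` is its scaling in the accelerated
algorithm. -/
noncomputable def blockProx (φ : ∀ j, EuclideanSpace ℝ (Fin (s j)) → EReal) (w : Fin N → ℝ)
    (τ₀ τ β : ℝ) (Δ z : Block s) (j : Fin N) : EuclideanSpace ℝ (Fin (s j)) :=
  prox (fun u => ((τ₀ * β / (τ * w j) : ℝ) : EReal) * φ j u)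
    (z j - (τ₀ * β / (τ * w j)) • Δ j)

/-- The part of the change of the Lyapunov function that is due to moving block `j` from `z j` to
`u`: the linearized change of the objective, the quadratic error of the linearization, and the
change of the distance to the reference point `zs`, when block `j` is drawn with probability
`q j`. -/
noncomputable def blockCost (φ : ∀ j, EuclideanSpace ℝ (Fin (s j)) → EReal) (w q : Fin N → ℝ)
    (τ₀ τ β μ : ℝ) (Δ z zs : Block s) (j : Fin N) (u : EuclideanSpace ℝ (Fin (s j))) : ℝ :=
  τ / τ₀ * ((φ j u).toReal - (φ j (z j)).toReal + inner ℝ (Δ j) (u - z j))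
    + (τ / τ₀) ^ 2 / (2 * β) * (w j * ‖u - z j‖ ^ 2)
    + (τ ^ 2 / (2 * τ₀ * β) + τ * μ / 2) * (w j / q j * (‖u - zs j‖ ^ 2 - ‖z j - zs j‖ ^ 2))

variable {φ : ∀ j, EuclideanSpace ℝ (Fin (s j)) → EReal} {w q μφ : Fin N → ℝ} {τ₀ τ β μ : ℝ}

lemma isProx_blockProx (hp : ∀ j, EProper (φ j)) (hl : ∀ j, LowerSemicontinuous (φ j))
    (hμφ : ∀ j, 0 < μφ j) (hs : ∀ j, EStrongConvex (μφ j) (φ j)) (hw : ∀ j, 0 < w j)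
    (hτ₀ : 0 < τ₀) (hτ : 0 < τ) (hβ : 0 < β) (Δ z : Block s) (j : Fin N) :
    IsProx (fun u => ((τ₀ * β / (τ * w j) : ℝ) : EReal) * φ j u)
      (z j - (τ₀ * β / (τ * w j)) • Δ j) (blockProx φ w τ₀ τ β Δ z j) :=
  isProx_prox (hp j) (hl j) (hμφ j) (hs j) (by have := hw j; positivity) _

lemma sum_mul_blockCost_blockProx_le (hp : ∀ j, EProper (φ j))
    (hl : ∀ j, LowerSemicontinuous (φ j)) (hμφ : ∀ j, 0 < μφ j)
    (hs : ∀ j, EStrongConvex (μφ j) (φ j)) (hw : ∀ j, 0 < w j) (hμ : 0 ≤ μ)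
    (hμw : ∀ j, μ * w j ≤ μφ j) (hτ₀ : 0 < τ₀) (hq : ∀ j, τ₀ ≤ q j) (hτ : 0 < τ) (hβ : 0 < β)
    {Δ z zs : Block s} (hz : ∀ j, z j ∈ edom (φ j)) (hzs : ∀ j, zs j ∈ edom (φ j)) :
    ∑ j, q j * blockCost φ w q τ₀ τ β μ Δ z zs j (blockProx φ w τ₀ τ β Δ z j)
      ≤ τ * (∑ j, (φ j (zs j)).toReal - ∑ j, (φ j (z j)).toReal + inner ℝ Δ (zs - z))
        - τ * μ * τ₀ / 2 * wnormSq (fun j => w j / q j) (z - zs) := by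
  rw [PiLp.inner_apply]
  simp only [wnormSq, PiLp.sub_apply, Finset.mul_sum, mul_add, mul_sub,
    ← Finset.sum_add_distrib, ← Finset.sum_sub_distrib]
  refine Finset.sum_le_sum fun j _ => ?_
  have hwj := hw j
  have hqj := hτ₀.trans_le (hq j)
  have hprogress := (isProx_blockProx hp hl hμφ hs hw hτ₀ hτ hβ Δ z j).progress_le (hp j) (hs j)
    (hμφ j).le (hμw j) (by positivity) ((one_le_div hτ₀).2 (hq j)) (hz j) (hzs j)
  have hweight : μ * τ₀ / 2 * (w j / q j * ‖z j - zs j‖ ^ 2)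
      ≤ μ * w j / 2 * ‖z j - zs j‖ ^ 2 := by
    rw [show μ * τ₀ / 2 * (w j / q j * ‖z j - zs j‖ ^ 2)
      = μ * w j / 2 * ‖z j - zs j‖ ^ 2 * (τ₀ / q j) by ring]
    exact mul_le_of_le_one_right (by positivity) ((div_le_one hqj).2 (hq j))
  set u := blockProx φ w τ₀ τ β Δ z j
  have hcost : q j * blockCost φ w q τ₀ τ β μ Δ z zs j u
      = τ * (q j / τ₀ * ((φ j u).toReal - (φ j (z j)).toReal + inner ℝ (Δ j) (u - z j)
          + 1 / (2 * (τ₀ * β / (τ * w j))) * ‖u - z j‖ ^ 2)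
        + (1 / (2 * (τ₀ * β / (τ * w j))) + μ * w j / 2)
          * (‖u - zs j‖ ^ 2 - ‖z j - zs j‖ ^ 2)) := by
    rw [blockCost]
    field_simp
  rw [hcost]
  linarith [mul_le_mul_of_nonneg_left (hprogress.trans (sub_le_sub_left hweight _)) hτ.le]

end BlockProx

lemma sum_sum_mul_le {ι κ : Type*} [Fintype ι] [Fintype κ] {q : ι → ℝ} {q' : κ → ℝ}
    (hq : ∀ i, 0 ≤ q i) (hq1 : ∑ i, q i = 1) (hq' : ∀ j, 0 ≤ q' j) (hq'1 : ∑ j, q' j = 1)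
    {V : ι → κ → ℝ} {C : ℝ} {A : κ → ℝ} {B : ι → ℝ} (h : ∀ i j, V i j ≤ C + A j + B i) :
    ∑ i, ∑ j, q i * q' j * V i j ≤ C + ∑ j, q' j * A j + ∑ i, q i * B i := by
  calc ∑ i, ∑ j, q i * q' j * V i j
      ≤ ∑ i, ∑ j, q i * q' j * (C + A j + B i) := by
        gcongr with i _ j _
        · exact mul_nonneg (hq i) (hq' j)
        · exact h i j
    _ = ∑ i, (q i * (∑ j, q' j) * C + q i * (∑ j, q' j * A j) + q i * B i * ∑ j, q' j) := by
        simp only [Finset.mul_sum, Finset.sum_mul, ← Finset.sum_add_distrib]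
        exact Finset.sum_congr rfl fun i _ => Finset.sum_congr rfl fun j _ => by ring
    _ = C + ∑ j, q' j * A j + ∑ i, q i * B i := by
        simp only [hq'1, mul_one, Finset.sum_add_distrib, ← Finset.sum_mul, hq1, one_mul]

section AugmentedLagrangian

variable {E : Type*} [NormedAddCommGroup E] [InnerProductSpace ℝ E]

lemma norm_add_sq_le_two_mul (a b : E) : ‖a + b‖ ^ 2 ≤ 2 * (‖a‖ ^ 2 + ‖b‖ ^ 2) := by
  linarith [parallelogram_law_with_norm ℝ a b, mul_self_nonneg ‖a - b‖, sq ‖a + b‖, sq ‖a‖, sq ‖b‖]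

lemma norm_smul_sub_sq_le (κ : ℝ) (a b : E) :
    ‖κ • (a - b)‖ ^ 2 ≤ 2 * κ ^ 2 * (‖a‖ ^ 2 + ‖b‖ ^ 2) := by
  rw [norm_smul, mul_pow, Real.norm_eq_abs, sq_abs, mul_comm 2, mul_assoc, sub_eq_add_neg,
    ← norm_neg b]
  gcongr
  exact norm_add_sq_le_two_mul a (-b)

/-- Half of the quadratic penalty pays for the multiplier step of length `ρ / 2`. -/
lemma augmentedLagrangian_update_le {τ ρ : ℝ} (hρ : 0 < ρ) (z zt δ y ys : E) :
    inner ℝ ys ((1 - τ) • z + τ • zt + δ) + ρ / 2 * ‖(1 - τ) • z + τ • zt + δ‖ ^ 2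
        + 1 / ρ * ‖y + (ρ / 2) • (τ • zt + δ) - ys‖ ^ 2
      ≤ inner ℝ y ((1 - τ) • z + τ • zt) + ρ / 2 * ‖(1 - τ) • z + τ • zt‖ ^ 2
        + inner ℝ (y + ρ • ((1 - τ) • z + τ • zt)) δ + ρ * ‖δ‖ ^ 2
        - (1 - τ) * inner ℝ (y - ys) z + 1 / ρ * ‖y - ys‖ ^ 2 + ρ / 2 * τ ^ 2 * ‖zt‖ ^ 2 := by
  set zh := (1 - τ) • z + τ • zt with hzh
  have hpenalty : ‖zh + δ‖ ^ 2 = ‖zh‖ ^ 2 + 2 * inner ℝ zh δ + ‖δ‖ ^ 2 := norm_add_sq_real _ _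
  have hmultiplier : 1 / ρ * ‖y + (ρ / 2) • (τ • zt + δ) - ys‖ ^ 2
      = 1 / ρ * ‖y - ys‖ ^ 2 + inner ℝ (y - ys) (τ • zt + δ) + ρ / 4 * ‖τ • zt + δ‖ ^ 2 := by
    rw [show y + (ρ / 2) • (τ • zt + δ) - ys = (y - ys) + (ρ / 2) • (τ • zt + δ) by abel,
      norm_add_sq_real, inner_smul_right, norm_smul, mul_pow, Real.norm_eq_abs, sq_abs]
    field_simp
    ring
  have hincrement : ρ / 4 * ‖τ • zt + δ‖ ^ 2 ≤ ρ / 2 * τ ^ 2 * ‖zt‖ ^ 2 + ρ / 2 * ‖δ‖ ^ 2 := by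
    have hsq := norm_add_sq_le_two_mul (τ • zt) δ
    rw [norm_smul, mul_pow, Real.norm_eq_abs, sq_abs] at hsq
    linarith [mul_le_mul_of_nonneg_left hsq (show 0 ≤ ρ / 4 by positivity)]
  have hextrapolation : inner ℝ (y - ys) (τ • zt + δ)
      = inner ℝ (y - ys) (zh + δ) - (1 - τ) * inner ℝ (y - ys) z := by
    rw [← inner_smul_right, ← inner_sub_right, hzh]
    congr 1
    module
  rw [hpenalty, hmultiplier, hextrapolation]
  simp only [inner_add_left, inner_add_right, inner_sub_left, inner_smul_left,
    RCLike.conj_to_real]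
  linarith

end AugmentedLagrangian

namespace Problem

variable {m n : ℕ} {p : Fin n → ℕ} {d : Fin m → ℕ}

/-- The extrapolated point `x̂`. -/
noncomputable def hatX (τ : ℝ) (s : State p d) : Block p := (1 - τ) • s.x + τ • s.xt

/-- The extrapolated point `r̂`. -/
noncomputable def hatR (τ : ℝ) (s : State p d) : Block d := (1 - τ) • s.r + τ • s.rt

/-- The residual `K x - r`. -/
def resid (Pb : Problem p d) (s : State p d) : Block d := Pb.K s.x - s.r

/-- The residual `K x̃ - r̃`. -/
def residT (Pb : Problem p d) (s : State p d) : Block d := Pb.K s.xt - s.rt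

/-- The multiplier `ŷ + ρ (K x̂ - r̂)` of the augmented Lagrangian at the extrapolated point. -/
noncomputable def hatY (Pb : Problem p d) (τ ρ : ℝ) (s : State p d) : Block d :=
  s.yhat + ρ • (Pb.K (hatX τ s) - hatR τ s)

/-- The gradient in `x` of the smooth part of the augmented Lagrangian at the extrapolated
point; the gradient in `r` is `-Pb.hatY τ ρ s`. -/
noncomputable def gradX (Pb : Problem p d) (τ ρ : ℝ) (s : State p d) : Block p :=
  gradient Pb.h (hatX τ s) + ContinuousLinearMap.adjoint Pb.K (Pb.hatY τ ρ s)

/-- The candidate for block `j` of `x̃` in the next iteration. -/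
noncomputable def proxX (Pb : Problem p d) (σ : Fin n → ℝ) (τ₀ τ ρ β : ℝ) (s : State p d) :
    ∀ j, EuclideanSpace ℝ (Fin (p j)) :=
  blockProx Pb.f σ τ₀ τ β (Pb.gradX τ ρ s) s.xt

/-- The candidate for block `i` of `r̃` in the next iteration. -/
noncomputable def proxR (Pb : Problem p d) (τ₀ τ ρ γ : ℝ) (s : State p d) :
    ∀ i, EuclideanSpace ℝ (Fin (d i)) :=
  blockProx Pb.g (fun _ => 1) τ₀ τ γ (-Pb.hatY τ ρ s) s.rt

lemma resid_hat (Pb : Problem p d) (τ : ℝ) (s : State p d) :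
    Pb.K (hatX τ s) - hatR τ s = (1 - τ) • Pb.resid s + τ • Pb.residT s := by
  simp only [hatX, hatR, resid, residT, map_add, map_smul]
  module

section Step

variable (Pb : Problem p d) (σ : Fin n → ℝ) (τ₀ τ ρ γ β η : ℝ) (i : Fin m) (j : Fin n)
  (s : State p d)

lemma step_xt : (Pb.step σ τ₀ τ ρ γ β η i j s).xt = setBlock s.xt j (Pb.proxX σ τ₀ τ ρ β s j) :=
  rfl

lemma step_rt : (Pb.step σ τ₀ τ ρ γ β η i j s).rt = setBlock s.rt i (Pb.proxR τ₀ τ ρ γ s i) := by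
  have hgrad : -(s.yhat i) + ρ • (hatR τ s i - Pb.K (hatX τ s) i) = (-Pb.hatY τ ρ s) i := by
    rw [hatY, PiLp.neg_apply, PiLp.add_apply, PiLp.smul_apply, PiLp.sub_apply]
    module
  rw [proxR, blockProx, ← hgrad, mul_one, mul_comm τ₀ γ]
  simp only [step, hatR, hatX, mul_comm τ₀ γ]

lemma step_x : (Pb.step σ τ₀ τ ρ γ β η i j s).x
    = hatX τ s + blockIncl j ((τ / τ₀) • (Pb.proxX σ τ₀ τ ρ β s j - s.xt j)) := by
  rw [← smul_blockIncl, ← setBlock_sub]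
  rfl

lemma step_r : (Pb.step σ τ₀ τ ρ γ β η i j s).r
    = hatR τ s + blockIncl i ((τ / τ₀) • (Pb.proxR τ₀ τ ρ γ s i - s.rt i)) := by
  rw [← smul_blockIncl, ← setBlock_sub, ← step_rt (σ := σ) (β := β) (η := η) (j := j)]
  rfl

lemma resid_step : Pb.resid (Pb.step σ τ₀ τ ρ γ β η i j s)
    = (1 - τ) • Pb.resid s + τ • Pb.residT s
      + (τ / τ₀) • (Pb.K (blockIncl j (Pb.proxX σ τ₀ τ ρ β s j - s.xt j))
        - blockIncl i (Pb.proxR τ₀ τ ρ γ s i - s.rt i)) := by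
  rw [← resid_hat, resid, step_x, step_r, map_add, ← smul_blockIncl, ← smul_blockIncl, map_smul]
  module

lemma step_yhat : (Pb.step σ τ₀ τ ρ γ β η i j s).yhat
    = s.yhat + η • (τ • Pb.residT s
      + (τ / τ₀) • (Pb.K (blockIncl j (Pb.proxX σ τ₀ τ ρ β s j - s.xt j))
        - blockIncl i (Pb.proxR τ₀ τ ρ γ s i - s.rt i))) := by
  change s.yhat + η • (Pb.resid (Pb.step σ τ₀ τ ρ γ β η i j s) - (1 - τ) • Pb.resid s) = _
  rw [resid_step]
  congr 2
  abel

end Step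

/-- The value of the smooth part of the augmented Lagrangian at the extrapolated point, together
with the terms that the multiplier update leaves behind. -/
noncomputable def modelValue (Pb : Problem p d) (τ ρ : ℝ) (ys : Block d) (s : State p d) : ℝ :=
  Pb.h (hatX τ s) + inner ℝ s.yhat (Pb.K (hatX τ s) - hatR τ s)
    + ρ / 2 * ‖Pb.K (hatX τ s) - hatR τ s‖ ^ 2
    - (1 - τ) * inner ℝ (s.yhat - ys) (Pb.resid s) + 1 / ρ * ‖s.yhat - ys‖ ^ 2
    + ρ / 2 * τ ^ 2 * ‖Pb.residT s‖ ^ 2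

section Progress

variable {Pb : Problem p d} {Lh σ : Fin n → ℝ} (hA : Pb.Standing Lh)
include hA

lemma Standing.h_hatX_add_le (hσ : ∀ j, 0 < σ j) (τ κ : ℝ) (s : State p d) (j : Fin n)
    (v : EuclideanSpace ℝ (Fin (p j))) :
    Pb.h (hatX τ s + blockIncl j (κ • v)) ≤ Pb.h (hatX τ s)
      + κ * inner ℝ (gradient Pb.h (hatX τ s) j) v
      + LhSigma σ Lh / 2 * κ ^ 2 * (σ j * ‖v‖ ^ 2) := by
  have hdesc := block_descent hA.h_diff (hA.h_smooth j) (hatX τ s) (κ • v)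
  rw [inner_smul_right, norm_smul, mul_pow, Real.norm_eq_abs, sq_abs] at hdesc
  have hL : Lh j / 2 * (κ ^ 2 * ‖v‖ ^ 2) ≤ LhSigma σ Lh * σ j / 2 * (κ ^ 2 * ‖v‖ ^ 2) := by
    gcongr
    exact le_LhSigma_mul hσ Lh j
  linarith

lemma Standing.lagrangian_step_le (hσ : ∀ j, 0 < σ j) {τ₀ τ ρ β γ : ℝ} (hρ : 0 < ρ)
    (hβ : 1 / β = LhSigma σ Lh + 4 * Pb.Lbar σ * ρ) (hγ : 1 / γ = 4 * ρ)
    (s : State p d) (ys : Block d) (i : Fin m) (j : Fin n) :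
    Pb.h (Pb.step σ τ₀ τ ρ γ β (ρ / 2) i j s).x
        + inner ℝ ys (Pb.resid (Pb.step σ τ₀ τ ρ γ β (ρ / 2) i j s))
        + ρ / 2 * ‖Pb.resid (Pb.step σ τ₀ τ ρ γ β (ρ / 2) i j s)‖ ^ 2
        + 1 / ρ * ‖(Pb.step σ τ₀ τ ρ γ β (ρ / 2) i j s).yhat - ys‖ ^ 2
      ≤ Pb.modelValue τ ρ ys s
        + (τ / τ₀ * inner ℝ (Pb.gradX τ ρ s j) (Pb.proxX σ τ₀ τ ρ β s j - s.xt j)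
          + (τ / τ₀) ^ 2 / (2 * β) * (σ j * ‖Pb.proxX σ τ₀ τ ρ β s j - s.xt j‖ ^ 2))
        + (τ / τ₀ * inner ℝ ((-Pb.hatY τ ρ s) i) (Pb.proxR τ₀ τ ρ γ s i - s.rt i)
          + (τ / τ₀) ^ 2 / (2 * γ) * (1 * ‖Pb.proxR τ₀ τ ρ γ s i - s.rt i‖ ^ 2)) := by
  rw [resid_step, step_yhat, step_x, modelValue]
  set dx := Pb.proxX σ τ₀ τ ρ β s j - s.xt j
  set dr := Pb.proxR τ₀ τ ρ γ s i - s.rt i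
  set κ := τ / τ₀
  have hdesc := hA.h_hatX_add_le hσ τ κ s j dx
  have haug := augmentedLagrangian_update_le (τ := τ) hρ (Pb.resid s) (Pb.residT s)
    (κ • (Pb.K (blockIncl j dx) - blockIncl i dr)) s.yhat ys
  have hlinear : inner ℝ (Pb.hatY τ ρ s) (κ • (Pb.K (blockIncl j dx) - blockIncl i dr))
      = κ * (inner ℝ (Pb.gradX τ ρ s j) dx - inner ℝ (gradient Pb.h (hatX τ s) j) dx)
        + κ * inner ℝ ((-Pb.hatY τ ρ s) i) dr := by
    rw [inner_smul_right, inner_sub_right, ← ContinuousLinearMap.adjoint_inner_left,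
      inner_blockIncl, inner_blockIncl, gradX, PiLp.add_apply, PiLp.neg_apply, inner_neg_left,
      inner_add_left]
    ring
  have hquadratic : ρ * ‖κ • (Pb.K (blockIncl j dx) - blockIncl i dr)‖ ^ 2
      ≤ 2 * ρ * κ ^ 2 * (Pb.Lbar σ * (σ j * ‖dx‖ ^ 2) + ‖dr‖ ^ 2) := by
    rw [mul_comm 2 ρ, mul_assoc ρ, mul_assoc ρ]
    refine mul_le_mul_of_nonneg_left ((norm_smul_sub_sq_le κ _ _).trans ?_) hρ.le
    rw [norm_blockIncl]
    gcongr
    exact norm_map_blockIncl_sq_le Pb hσ j dx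
  rw [← resid_hat] at haug ⊢
  rw [← hatY, hlinear] at haug
  rw [show κ ^ 2 / (2 * β) = κ ^ 2 / 2 * (1 / β) by ring,
    show κ ^ 2 / (2 * γ) = κ ^ 2 / 2 * (1 / γ) by ring, hβ, hγ]
  linarith

end Progress

end Problem

/-- One step of the recursion relating the averaged iterates `x`, `r` to the auxiliary iterates
`x̃`, `r̃`, which move from `b` to `b'`. -/
noncomputable def extrapolate {E : Type*} [AddCommGroup E] [Module ℝ E] (τ₀ τ : ℝ) (a b b' : E) :
    E :=
  (1 - τ) • a + τ • b + (τ / τ₀) • (b' - b)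

namespace Problem

variable {m n : ℕ} {p : Fin n → ℕ} {d : Fin m → ℕ}

/-- The value `f(x̃) + g(r̃)` at the auxiliary iterates. -/
def auxValue (Pb : Problem p d) (s : State p d) : ℝ := Pb.fR s.xt + Pb.gR s.rt

/-- The augmented Lagrangian gap, where `v` stands for an upper bound of `f(x) + g(r)`. -/
noncomputable def lagrangianGap (Pb : Problem p d) (ρ : ℝ) (xs : Block p) (ys : Block d) (v : ℝ)
    (s : State p d) : ℝ :=
  v + Pb.h s.x + inner ℝ ys (Pb.resid s) - Pb.FR xs + ρ / 2 * ‖Pb.resid s‖ ^ 2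

/-- The Lyapunov function of the algorithm before rescaling; `a` and `b` are the coefficients of
the distances of `x̃` and `r̃` to the solution. -/
noncomputable def energy (Pb : Problem p d) (σ q : Fin n → ℝ) (qhat : Fin m → ℝ) (ρ a b : ℝ)
    (xs : Block p) (ys : Block d) (v : ℝ) (s : State p d) : ℝ :=
  Pb.lagrangianGap ρ xs ys v s + 1 / ρ * ‖s.yhat - ys‖ ^ 2
    + a * wnormSq (fun j => σ j / q j) (s.xt - xs)
    + b * wnormSq (fun i => 1 / qhat i) (s.rt - Pb.K xs)

section Progress

variable {Pb : Problem p d} {Lh μf σ q : Fin n → ℝ} {μg qhat : Fin m → ℝ} (hA : Pb.Standing Lh)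
include hA

lemma Standing.energy_step_le (hσ : ∀ j, 0 < σ j) {τ₀ τ ρ β γ : ℝ} (hρ : 0 < ρ)
    (hβ : 1 / β = LhSigma σ Lh + 4 * Pb.Lbar σ * ρ) (hγ : 1 / γ = 4 * ρ) (μ ν : ℝ)
    (xs : Block p) (ys : Block d) (v : ℝ) (s : State p d) (i : Fin m) (j : Fin n) :
    Pb.energy σ q qhat ρ (τ ^ 2 / (2 * τ₀ * β) + τ * μ / 2) (τ ^ 2 / (2 * τ₀ * γ) + τ * ν / 2)
        xs ys (extrapolate τ₀ τ v (Pb.auxValue s)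
          (Pb.auxValue (Pb.step σ τ₀ τ ρ γ β (ρ / 2) i j s)))
        (Pb.step σ τ₀ τ ρ γ β (ρ / 2) i j s)
      ≤ ((1 - τ) * v + τ * Pb.auxValue s - Pb.FR xs + Pb.modelValue τ ρ ys s
          + (τ ^ 2 / (2 * τ₀ * β) + τ * μ / 2) * wnormSq (fun j => σ j / q j) (s.xt - xs)
          + (τ ^ 2 / (2 * τ₀ * γ) + τ * ν / 2)
            * wnormSq (fun i => 1 / qhat i) (s.rt - Pb.K xs))
        + blockCost Pb.f σ q τ₀ τ β μ (Pb.gradX τ ρ s) s.xt xs j (Pb.proxX σ τ₀ τ ρ β s j)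
        + blockCost Pb.g (fun _ => 1) qhat τ₀ τ γ ν (-Pb.hatY τ ρ s) s.rt (Pb.K xs) i
          (Pb.proxR τ₀ τ ρ γ s i) := by
  have hstep := hA.lagrangian_step_le hσ (τ₀ := τ₀) (τ := τ) hρ hβ hγ s ys i j
  have hvalue : Pb.auxValue (Pb.step σ τ₀ τ ρ γ β (ρ / 2) i j s) = Pb.auxValue s
      + ((Pb.f j (Pb.proxX σ τ₀ τ ρ β s j)).toReal - (Pb.f j (s.xt j)).toReal)
      + ((Pb.g i (Pb.proxR τ₀ τ ρ γ s i)).toReal - (Pb.g i (s.rt i)).toReal) := by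
    rw [auxValue, auxValue, step_xt, step_rt, fR, fR, gR, gR,
      sum_setBlock (fun j u => (Pb.f j u).toReal), sum_setBlock (fun i u => (Pb.g i u).toReal)]
    ring
  rw [energy, lagrangianGap, hvalue, step_xt, step_rt, wnormSq_setBlock_sub,
    wnormSq_setBlock_sub]
  simp only [extrapolate, blockCost, smul_eq_mul]
  linarith

lemma Standing.h_hatX_add_inner_le {τ : ℝ} (hτ : 0 ≤ τ) (hτ1 : τ ≤ 1) (xs : Block p)
    (s : State p d) :
    Pb.h (hatX τ s) + τ * inner ℝ (gradient Pb.h (hatX τ s)) (xs - s.xt)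
      ≤ (1 - τ) * Pb.h s.x + τ * Pb.h xs := by
  have hgrad := add_inner_gradient_le_of_convexOn hA.h_convex hA.h_diff (hatX τ s)
    ((1 - τ) • s.x + τ • xs)
  rw [show (1 - τ) • s.x + τ • xs - hatX τ s = τ • (xs - s.xt) by rw [hatX]; module,
    inner_smul_right] at hgrad
  exact hgrad.trans (hA.h_convex.2 (Set.mem_univ s.x) (Set.mem_univ xs) (sub_nonneg.2 hτ1) hτ
    (sub_add_cancel _ _))

lemma Standing.modelValue_add_inner_le {τ : ℝ} (hτ : 0 ≤ τ) (hτ1 : τ ≤ 1) (ρ : ℝ)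
    (xs : Block p) (ys : Block d) (s : State p d) :
    Pb.modelValue τ ρ ys s + τ * inner ℝ (Pb.gradX τ ρ s) (xs - s.xt)
        + τ * inner ℝ (-Pb.hatY τ ρ s) (Pb.K xs - s.rt)
      ≤ (1 - τ) * (Pb.h s.x + inner ℝ ys (Pb.resid s)) + τ * Pb.h xs
        + (1 - τ) ^ 2 * (ρ / 2 * ‖Pb.resid s‖ ^ 2) + 1 / ρ * ‖s.yhat - ys‖ ^ 2 := by
  have hconv := hA.h_hatX_add_inner_le hτ hτ1 xs s
  have hinner : inner ℝ (Pb.gradX τ ρ s) (xs - s.xt)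
      = inner ℝ (gradient Pb.h (hatX τ s)) (xs - s.xt)
        + inner ℝ (Pb.hatY τ ρ s) (Pb.K xs - s.rt) - inner ℝ (Pb.hatY τ ρ s) (Pb.residT s) := by
    rw [gradX, inner_add_left, ContinuousLinearMap.adjoint_inner_left, residT, map_sub]
    simp only [inner_sub_right]
    ring
  have hquad : inner ℝ s.yhat (Pb.K (hatX τ s) - hatR τ s)
        + ρ / 2 * ‖Pb.K (hatX τ s) - hatR τ s‖ ^ 2 - τ * inner ℝ (Pb.hatY τ ρ s) (Pb.residT s)
        - (1 - τ) * inner ℝ (s.yhat - ys) (Pb.resid s) + ρ / 2 * τ ^ 2 * ‖Pb.residT s‖ ^ 2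
      = (1 - τ) * inner ℝ ys (Pb.resid s) + (1 - τ) ^ 2 * (ρ / 2 * ‖Pb.resid s‖ ^ 2) := by
    rw [hatY, resid_hat]
    simp only [← real_inner_self_eq_norm_sq, inner_add_left, inner_add_right, inner_sub_left,
      inner_smul_left, inner_smul_right, RCLike.conj_to_real,
      real_inner_comm (Pb.resid s) (Pb.residT s)]
    ring
  rw [modelValue, hinner, inner_neg_left]
  linarith

lemma Standing.sum_energy_step_le
    (hμf : ∀ j, 0 < μf j) (hf : ∀ j, EStrongConvex (μf j) (Pb.f j))
    (hμg : ∀ i, 0 < μg i) (hg : ∀ i, EStrongConvex (μg i) (Pb.g i)) (hσ : ∀ j, 0 < σ j)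
    (hq1 : ∑ j, q j = 1) (hqhat1 : ∑ i, qhat i = 1)
    {τ₀ τ ρ β γ : ℝ} (hτ₀ : 0 < τ₀) (hq : ∀ j, τ₀ ≤ q j) (hqhat : ∀ i, τ₀ ≤ qhat i)
    (hτ : 0 < τ) (hτ1 : τ ≤ 1) (hρ : 0 < ρ) (hβ0 : 0 < β) (hγ0 : 0 < γ)
    (hβ : 1 / β = LhSigma σ Lh + 4 * Pb.Lbar σ * ρ) (hγ : 1 / γ = 4 * ρ)
    {xs : Block p} (hxs : xs ∈ edom Pb.fSum) (hKxs : Pb.K xs ∈ edom Pb.gSum) (ys : Block d)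
    (v : ℝ) {s : State p d} (hxt : s.xt ∈ edom Pb.fSum) (hrt : s.rt ∈ edom Pb.gSum) :
    ∑ i, ∑ j, qhat i * q j * Pb.energy σ q qhat ρ
        (τ ^ 2 / (2 * τ₀ * β) + τ * muSigma σ μf / 2) (τ ^ 2 / (2 * τ₀ * γ) + τ * muMin μg / 2)
        xs ys (extrapolate τ₀ τ v (Pb.auxValue s)
          (Pb.auxValue (Pb.step σ τ₀ τ ρ γ β (ρ / 2) i j s)))
        (Pb.step σ τ₀ τ ρ γ β (ρ / 2) i j s)
      ≤ (1 - τ) * Pb.lagrangianGap ((1 - τ) * ρ) xs ys v s + 1 / ρ * ‖s.yhat - ys‖ ^ 2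
        + (τ ^ 2 / (2 * τ₀ * β) + (1 - τ₀) * (τ * muSigma σ μf / 2))
          * wnormSq (fun j => σ j / q j) (s.xt - xs)
        + (τ ^ 2 / (2 * τ₀ * γ) + (1 - τ₀) * (τ * muMin μg / 2))
          * wnormSq (fun i => 1 / qhat i) (s.rt - Pb.K xs) := by
  have hmuf : 0 ≤ muSigma σ μf := Real.iInf_nonneg fun j => (div_pos (hμf j) (hσ j)).le
  have hmug : 0 ≤ muMin μg := Real.iInf_nonneg fun i => (hμg i).le
  have hcostX := sum_mul_blockCost_blockProx_le (component_proper hA.f_proper)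
    (component_closed hA.f_proper hA.f_closed) hμf hf hσ hmuf (muSigma_mul_le hσ μf) hτ₀ hq hτ hβ0
    (Δ := Pb.gradX τ ρ s) ((mem_edom_sum_iff hA.f_proper.2).1 hxt)
    ((mem_edom_sum_iff hA.f_proper.2).1 hxs)
  have hcostR := sum_mul_blockCost_blockProx_le (component_proper hA.g_proper)
    (component_closed hA.g_proper hA.g_closed) hμg hg (w := fun _ => 1) (fun _ => one_pos) hmug
    (fun i => (mul_one _).trans_le (muMin_le μg i)) hτ₀ hqhat hτ hγ0
    (Δ := -Pb.hatY τ ρ s) ((mem_edom_sum_iff hA.g_proper.2).1 hrt)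
    ((mem_edom_sum_iff hA.g_proper.2).1 hKxs)
  have hmodel := hA.modelValue_add_inner_le hτ.le hτ1 ρ xs ys s
  refine (sum_sum_mul_le (fun i => hτ₀.le.trans (hqhat i)) hqhat1 (fun j => hτ₀.le.trans (hq j))
    hq1 (fun i j => hA.energy_step_le hσ hρ hβ hγ _ _ xs ys v s i j)).trans ?_
  refine (add_le_add (add_le_add_right hcostX _) hcostR).trans ?_
  simp only [auxValue, FR, lagrangianGap, fR, gR]
  linarith

end Progress

end Problem

namespace Problem

variable {m n : ℕ} {p : Fin n → ℕ} {d : Fin m → ℕ}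

/-- The iteration with the coupled parameters `τ = τ₀ / θ`, `ρ = ρ₀ θ ^ 2`, `γ = 1 / (4 ρ)`,
`β = 1 / (L^h_σ + 4 L̄_σ ρ)` and `η = ρ / 2`; the algorithm uses `θ = (k + c) / c`. -/
noncomputable def scaledStep (Pb : Problem p d) (Lh σ : Fin n → ℝ) (τ₀ ρ₀ θ : ℝ)
    (e : Fin m × Fin n) (s : State p d) : State p d :=
  Pb.step σ τ₀ (τ₀ / θ) (ρ₀ * θ ^ 2) (1 / (4 * (ρ₀ * θ ^ 2)))
    (1 / (LhSigma σ Lh + 4 * Pb.Lbar σ * (ρ₀ * θ ^ 2))) (ρ₀ * θ ^ 2 / 2) e.1 e.2 s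

/-- The Lyapunov function of the algorithm at the scale `θ`. -/
noncomputable def lyapunov (Pb : Problem p d) (Lh μf σ q : Fin n → ℝ) (μg qhat : Fin m → ℝ)
    (τ₀ ρ₀ θ : ℝ) (xs : Block p) (ys : Block d) (v : ℝ) (s : State p d) : ℝ :=
  θ ^ 2 * Pb.lagrangianGap (ρ₀ * θ ^ 2) xs ys v s + 1 / ρ₀ * ‖s.yhat - ys‖ ^ 2
    + τ₀ / 2 * (LhSigma σ Lh + 4 * (ρ₀ * Pb.Lbar σ) * θ ^ 2 + muSigma σ μf * θ)
      * wnormSq (fun j => σ j / q j) (s.xt - xs)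
    + τ₀ / 2 * (4 * ρ₀ * θ ^ 2 + muMin μg * θ)
      * wnormSq (fun i => 1 / qhat i) (s.rt - Pb.K xs)

/-- The hypotheses under which one iteration decreases the Lyapunov function in expectation:
strong convexity, sampling probabilities `q`, `qhat` bounded below by `τ₀`, and a small `ρ₀`. -/
structure StrongSetting (Pb : Problem p d) (Lh μf σ q : Fin n → ℝ) (μg qhat : Fin m → ℝ)
    (τ₀ ρ₀ : ℝ) : Prop where
  standing : Pb.Standing Lh
  μf_pos : ∀ j, 0 < μf j
  f_strong : ∀ j, EStrongConvex (μf j) (Pb.f j)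
  μg_pos : ∀ i, 0 < μg i
  g_strong : ∀ i, EStrongConvex (μg i) (Pb.g i)
  σ_pos : ∀ j, 0 < σ j
  smooth_pos : 0 < LhSigma σ Lh + Pb.Lbar σ
  q_sum : ∑ j, q j = 1
  qhat_sum : ∑ i, qhat i = 1
  τ₀_pos : 0 < τ₀
  τ₀_le_q : ∀ j, τ₀ ≤ q j
  τ₀_le_qhat : ∀ i, τ₀ ≤ qhat i
  ρ₀_pos : 0 < ρ₀
  ρ₀_le : ρ₀ ≤ muMin μg / 8
  ρ₀_mul_le : ρ₀ * Pb.Lbar σ ≤ muSigma σ μf / 8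

/-- The iterates lie in the domains, and `v` is an upper bound of `f(x) + g(r)`. -/
structure Feasible (Pb : Problem p d) (v : ℝ) (s : State p d) : Prop where
  xt_mem : s.xt ∈ edom Pb.fSum
  rt_mem : s.rt ∈ edom Pb.gSum
  x_mem : s.x ∈ edom Pb.fSum
  r_mem : s.r ∈ edom Pb.gSum
  le_value : Pb.fR s.x + Pb.gR s.r ≤ v

lemma lyapunov_eq_mul_energy (Pb : Problem p d) (Lh μf σ q : Fin n → ℝ) (μg qhat : Fin m → ℝ)
    (τ₀ : ℝ) {ρ₀ : ℝ} (hρ₀ : ρ₀ ≠ 0) {θ : ℝ} (hθ : θ ≠ 0)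
    (xs : Block p) (ys : Block d) (v : ℝ) (s : State p d) :
    Pb.lyapunov Lh μf σ q μg qhat τ₀ ρ₀ θ xs ys v s = θ ^ 2 * Pb.energy σ q qhat (ρ₀ * θ ^ 2)
      ((τ₀ / θ) ^ 2 / (2 * τ₀ * (1 / (LhSigma σ Lh + 4 * Pb.Lbar σ * (ρ₀ * θ ^ 2))))
        + τ₀ / θ * muSigma σ μf / 2)
      ((τ₀ / θ) ^ 2 / (2 * τ₀ * (1 / (4 * (ρ₀ * θ ^ 2)))) + τ₀ / θ * muMin μg / 2) xs ys v s := by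
  rw [lyapunov, energy]
  field_simp

lemma Lbar_nonneg (Pb : Problem p d) (σ : Fin n → ℝ) : 0 ≤ Pb.Lbar σ := sq_nonneg _

lemma lagrangianGap_eq_add (Pb : Problem p d) (ρ : ℝ) (xs : Block p) (ys : Block d) (v : ℝ)
    (s : State p d) :
    Pb.lagrangianGap ρ xs ys v s = Pb.lagrangianGap 0 xs ys v s + ρ / 2 * ‖Pb.resid s‖ ^ 2 := by
  simp only [lagrangianGap]
  ring

lemma IsMultiplier.lagrangianGap_nonneg {Pb : Problem p d} {xs : Block p} {ys : Block d}
    (hys : Pb.IsMultiplier (Pb.FR xs) ys) {v : ℝ} {s : State p d} (hs : Pb.Feasible v s) {ρ : ℝ}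
    (hρ : 0 ≤ ρ) : 0 ≤ Pb.lagrangianGap ρ xs ys v s := by
  have hle := hys s.x hs.x_mem s.r hs.r_mem
  have hpenalty : 0 ≤ ρ / 2 * ‖Pb.resid s‖ ^ 2 := by positivity
  rw [lagrangianGap, resid] at *
  linarith [hs.le_value]

end Problem

lemma scale_decrement {κ μ τ₀ δ θ : ℝ} (hκ : 0 ≤ κ) (hκμ : κ ≤ μ / 8) (hδ : 0 ≤ δ)
    (hδτ : 2 * δ ≤ τ₀) (hθ : 1 ≤ θ) :
    4 * κ * θ ^ 2 + (1 - τ₀) * (μ * θ) ≤ 4 * κ * (θ - δ) ^ 2 + μ * (θ - δ) := by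
  have hμ : 0 ≤ μ := by linarith
  have hlinear : 0 ≤ μ * (θ * (τ₀ - 2 * δ)) :=
    mul_nonneg hμ (mul_nonneg (zero_le_one.trans hθ) (sub_nonneg.2 hδτ))
  have hmodulus : κ * (θ * δ) ≤ μ / 8 * (θ * δ) := by gcongr
  have hshift : μ * δ ≤ μ * (θ * δ) := by gcongr; exact le_mul_of_one_le_left hδ hθ
  have hsq : 0 ≤ κ * δ ^ 2 := by positivity
  linarith

lemma gap_decrement {S Z ρ₀ τ₀ δ θ : ℝ} (hS : 0 ≤ S) (hZ : 0 ≤ Z) (hρ₀ : 0 ≤ ρ₀)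
    (hτ₀ : τ₀ ≤ θ) (hδτ : 2 * δ ≤ τ₀) (hθ : 0 ≤ θ) :
    θ * (θ - τ₀) * S + (θ * (θ - τ₀)) ^ 2 * (ρ₀ / 2 * Z)
        + (τ₀ - 2 * δ) * θ * (S + ρ₀ * (θ - δ) ^ 2 / 2 * Z)
      ≤ (θ - δ) ^ 2 * (S + ρ₀ * (θ - δ) ^ 2 / 2 * Z) := by
  set A := (θ - δ) ^ 2
  set B := θ * (θ - τ₀)
  set D := (τ₀ - 2 * δ) * θ
  have hB : 0 ≤ B := mul_nonneg hθ (sub_nonneg.2 hτ₀)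
  have hD : 0 ≤ D := mul_nonneg (sub_nonneg.2 hδτ) hθ
  have hABD : B + D ≤ A := by
    linarith [show A = B + D + δ ^ 2 by simp only [A, B, D]; ring, sq_nonneg δ]
  have hlinear : (B + D) * S ≤ A * S := by gcongr
  have hquadratic : B ^ 2 + D * A ≤ A ^ 2 := by nlinarith
  have hpenalty : (B ^ 2 + D * A) * (ρ₀ / 2 * Z) ≤ A ^ 2 * (ρ₀ / 2 * Z) := by gcongr
  linarith

namespace Problem.StrongSetting

variable {m n : ℕ} {p : Fin n → ℕ} {d : Fin m → ℕ} {Pb : Problem p d}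
  {Lh μf σ q : Fin n → ℝ} {μg qhat : Fin m → ℝ} {τ₀ ρ₀ : ℝ}
  (hS : Pb.StrongSetting Lh μf σ q μg qhat τ₀ ρ₀)
include hS

lemma q_pos (j : Fin n) : 0 < q j := hS.τ₀_pos.trans_le (hS.τ₀_le_q j)

lemma qhat_pos (i : Fin m) : 0 < qhat i := hS.τ₀_pos.trans_le (hS.τ₀_le_qhat i)

lemma τ₀_le_one : τ₀ ≤ 1 := by
  obtain ⟨j, -⟩ : (Finset.univ : Finset (Fin n)).Nonempty :=
    Finset.nonempty_of_sum_ne_zero (hS.q_sum.trans_ne one_ne_zero)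
  exact (hS.τ₀_le_q j).trans (hS.q_sum ▸
    Finset.single_le_sum (fun j _ => (hS.q_pos j).le) (Finset.mem_univ j))

lemma muSigma_nonneg : 0 ≤ muSigma σ μf :=
  Real.iInf_nonneg fun j => (div_pos (hS.μf_pos j) (hS.σ_pos j)).le

lemma LhSigma_nonneg : 0 ≤ LhSigma σ Lh :=
  Real.iSup_nonneg fun j => div_nonneg (hS.standing.Lh_nonneg j) (hS.σ_pos j).le

lemma smooth_add_pos {ρ : ℝ} (hρ : 0 < ρ) : 0 < LhSigma σ Lh + 4 * Pb.Lbar σ * ρ := by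
  have hL := Pb.Lbar_nonneg σ
  rcases hS.LhSigma_nonneg.eq_or_lt with h | h
  · have : 0 < Pb.Lbar σ := by linarith [hS.smooth_pos]
    positivity
  · positivity

lemma sum_lyapunov_scaledStep_le {θ : ℝ} (hθ : 1 ≤ θ) {xs : Block p}
    (hxs : xs ∈ edom Pb.fSum) (hKxs : Pb.K xs ∈ edom Pb.gSum) (ys : Block d) {v : ℝ}
    {s : State p d} (hs : Pb.Feasible v s) :
    ∑ e : Fin m × Fin n, qhat e.1 * q e.2 * Pb.lyapunov Lh μf σ q μg qhat τ₀ ρ₀ θ xs ys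
        (extrapolate τ₀ (τ₀ / θ) v (Pb.auxValue s) (Pb.auxValue (Pb.scaledStep Lh σ τ₀ ρ₀ θ e s)))
        (Pb.scaledStep Lh σ τ₀ ρ₀ θ e s)
      ≤ θ * (θ - τ₀) * Pb.lagrangianGap 0 xs ys v s
        + (θ * (θ - τ₀)) ^ 2 * (ρ₀ / 2 * ‖Pb.resid s‖ ^ 2) + 1 / ρ₀ * ‖s.yhat - ys‖ ^ 2
        + τ₀ / 2 * (LhSigma σ Lh + (4 * (ρ₀ * Pb.Lbar σ) * θ ^ 2
            + (1 - τ₀) * (muSigma σ μf * θ))) * wnormSq (fun j => σ j / q j) (s.xt - xs)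
        + τ₀ / 2 * (4 * ρ₀ * θ ^ 2 + (1 - τ₀) * (muMin μg * θ))
          * wnormSq (fun i => 1 / qhat i) (s.rt - Pb.K xs) := by
  have hθ0 : 0 < θ := one_pos.trans_le hθ
  have hτ₀ := hS.τ₀_pos
  have hρ₀ := hS.ρ₀_pos
  have hρ : 0 < ρ₀ * θ ^ 2 := by positivity
  have henergy := hS.standing.sum_energy_step_le hS.μf_pos hS.f_strong hS.μg_pos hS.g_strong
    hS.σ_pos hS.q_sum hS.qhat_sum hτ₀ hS.τ₀_le_q hS.τ₀_le_qhat (div_pos hτ₀ hθ0)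
    ((div_le_one hθ0).2 (hS.τ₀_le_one.trans hθ)) hρ (one_div_pos.2 (hS.smooth_add_pos hρ))
    (one_div_pos.2 (by positivity : 0 < 4 * (ρ₀ * θ ^ 2))) (one_div_one_div _) (one_div_one_div _)
    hxs hKxs ys v hs.xt_mem hs.rt_mem
  simp only [lyapunov_eq_mul_energy _ _ _ _ _ _ _ _ hρ₀.ne' hθ0.ne', Fintype.sum_prod_type,
    scaledStep, mul_left_comm _ (θ ^ 2), ← Finset.mul_sum]
  refine (mul_le_mul_of_nonneg_left henergy (sq_nonneg θ)).trans_eq ?_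
  simp only [lagrangianGap]
  field_simp
  ring

lemma sum_lyapunov_scaledStep_add_le {θ δ : ℝ} (hθ : 1 ≤ θ) (hδ : 0 ≤ δ) (hδτ : 2 * δ ≤ τ₀)
    {xs : Block p} (hxs : xs ∈ edom Pb.fSum) (hKxs : Pb.K xs ∈ edom Pb.gSum)
    {ys : Block d} (hys : Pb.IsMultiplier (Pb.FR xs) ys) {v : ℝ} {s : State p d}
    (hs : Pb.Feasible v s) :
    ∑ e : Fin m × Fin n, qhat e.1 * q e.2 * Pb.lyapunov Lh μf σ q μg qhat τ₀ ρ₀ θ xs ys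
        (extrapolate τ₀ (τ₀ / θ) v (Pb.auxValue s) (Pb.auxValue (Pb.scaledStep Lh σ τ₀ ρ₀ θ e s)))
        (Pb.scaledStep Lh σ τ₀ ρ₀ θ e s)
      + (τ₀ - 2 * δ) * θ * Pb.lagrangianGap (ρ₀ * (θ - δ) ^ 2) xs ys v s
    ≤ Pb.lyapunov Lh μf σ q μg qhat τ₀ ρ₀ (θ - δ) xs ys v s := by
  have hτ₀ : 0 ≤ τ₀ / 2 := (half_pos hS.τ₀_pos).le
  have hsum := hS.sum_lyapunov_scaledStep_le hθ hxs hKxs ys hs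
  have hgap := gap_decrement (hys.lagrangianGap_nonneg hs le_rfl) (sq_nonneg ‖Pb.resid s‖)
    hS.ρ₀_pos.le (hS.τ₀_le_one.trans hθ) hδτ (zero_le_one.trans hθ)
  have hX := mul_le_mul_of_nonneg_right (mul_le_mul_of_nonneg_left
    (scale_decrement (mul_nonneg hS.ρ₀_pos.le (Pb.Lbar_nonneg σ)) hS.ρ₀_mul_le hδ hδτ hθ) hτ₀)
    (wnormSq_nonneg (fun j => (div_pos (hS.σ_pos j) (hS.q_pos j)).le) (s.xt - xs))
  have hR := mul_le_mul_of_nonneg_right (mul_le_mul_of_nonneg_left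
    (scale_decrement hS.ρ₀_pos.le hS.ρ₀_le hδ hδτ hθ) hτ₀)
    (wnormSq_nonneg (fun i => (one_div_pos.2 (hS.qhat_pos i)).le) (s.rt - Pb.K xs))
  rw [lyapunov, Pb.lagrangianGap_eq_add]
  linarith

end Problem.StrongSetting

section Average

variable {E F : Type*} [AddCommGroup E] [Module ℝ E] [AddCommGroup F] [Module ℝ F]

/-- The averaged sequence `x` generated by an auxiliary sequence `a = x̃` with steps `τ₀ / θ k`. -/
noncomputable def average (τ₀ : ℝ) (θ : ℕ → ℝ) (a : ℕ → E) : ℕ → E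
  | 0 => a 0
  | k + 1 => extrapolate τ₀ (τ₀ / θ k) (average τ₀ θ a k) (a k) (a (k + 1))

lemma average_prodMk (τ₀ : ℝ) (θ : ℕ → ℝ) (a : ℕ → E) (b : ℕ → F) (k : ℕ) :
    average τ₀ θ (fun k => (a k, b k)) k = (average τ₀ θ a k, average τ₀ θ b k) := by
  induction k with
  | zero => rfl
  | succ k ih => rw [average, ih]; rfl

variable {τ₀ : ℝ} {θ : ℕ → ℝ} {S : Set E} {a : ℕ → E}

/-- The weight `w` of the newest point `a k` pays for its coefficient `τ₀ / θ k - 1 / θ k ≤ 0` in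
the next average. -/
lemma exists_average_eq (hS : Convex ℝ S) (hτ₀ : 0 < τ₀) (hτ₀1 : τ₀ ≤ 1) (hθ0 : 1 ≤ θ 0)
    (hθ : Monotone θ) (ha : ∀ k, a k ∈ S) (k : ℕ) :
    ∃ w : ℝ, 0 ≤ w ∧ w ≤ 1 ∧ 1 - τ₀ ≤ (θ k - τ₀) * w ∧
      ∃ e ∈ S, average τ₀ θ a k = w • a k + (1 - w) • e := by
  induction k with
  | zero =>
    refine ⟨1, zero_le_one, le_rfl, by linarith, a 0, ha 0, ?_⟩
    rw [average]
    module
  | succ k ih =>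
    obtain ⟨w, -, hw1, hwk, e, he, heq⟩ := ih
    have hθk : 1 ≤ θ k := hθ0.trans (hθ k.zero_le)
    have hpos : 0 < θ k := one_pos.trans_le hθk
    refine ⟨1 / θ k, (one_div_pos.2 hpos).le, (div_le_one hpos).2 hθk, ?_, ?_⟩
    · have hmono := hθ k.le_succ
      rw [mul_one_div, le_div_iff₀ hpos]
      nlinarith
    · have hold : 0 ≤ (1 - τ₀ / θ k) * (1 - w) :=
        mul_nonneg (sub_nonneg.2 ((div_le_one hpos).2 (hτ₀1.trans hθk))) (sub_nonneg.2 hw1)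
      have hnew : 0 ≤ ((θ k - τ₀) * w - (1 - τ₀)) / θ k := div_nonneg (sub_nonneg.2 hwk) hpos.le
      obtain ⟨z, hz, hz_eq⟩ := hS.exists_mem_add_smul_eq he (ha k) hold hnew
      refine ⟨z, hz, ?_⟩
      rw [show 1 - 1 / θ k = (1 - τ₀ / θ k) * (1 - w) + ((θ k - τ₀) * w - (1 - τ₀)) / θ k by
        field_simp; ring, hz_eq, average, heq, extrapolate,
        show τ₀ / θ k / τ₀ = 1 / θ k by field_simp]
      match_scalars <;> field_simp
      ring

lemma average_mem (hS : Convex ℝ S) (hτ₀ : 0 < τ₀) (hτ₀1 : τ₀ ≤ 1) (hθ0 : 1 ≤ θ 0)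
    (hθ : Monotone θ) (ha : ∀ k, a k ∈ S) (k : ℕ) : average τ₀ θ a k ∈ S := by
  obtain ⟨w, hw0, hw1, -, e, he, heq⟩ := exists_average_eq hS hτ₀ hτ₀1 hθ0 hθ ha k
  rw [heq]
  exact hS (ha k) he hw0 (sub_nonneg.2 hw1) (add_sub_cancel _ _)

lemma le_average_of_convexOn {φ : E → ℝ} (hφ : ConvexOn ℝ S φ) (hτ₀ : 0 < τ₀) (hτ₀1 : τ₀ ≤ 1)
    (hθ0 : 1 ≤ θ 0) (hθ : Monotone θ) (ha : ∀ k, a k ∈ S) (k : ℕ) :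
    φ (average τ₀ θ a k) ≤ average τ₀ θ (fun k => φ (a k)) k := by
  have hepi := average_mem (a := fun k => (a k, φ (a k))) hφ.convex_epigraph hτ₀ hτ₀1 hθ0 hθ
    (fun k => ⟨ha k, le_rfl⟩) k
  rw [average_prodMk] at hepi
  exact hepi.2

end Average

namespace Problem

variable {m n : ℕ} {p : Fin n → ℕ} {d : Fin m → ℕ}

/-- The iterates for the index sequence `idx`, with the scale `θ k` in iteration `k`. -/
noncomputable def scaledRun (Pb : Problem p d) (Lh σ : Fin n → ℝ) (τ₀ ρ₀ : ℝ) (θ : ℕ → ℝ)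
    (x₀ : Block p) (y₀ : Block d) (idx : ℕ → Fin m × Fin n) : ℕ → State p d
  | 0 => ⟨x₀, x₀, Pb.K x₀, Pb.K x₀, y₀, y₀⟩
  | k + 1 => Pb.scaledStep Lh σ τ₀ ρ₀ (θ k) (idx k) (scaledRun Pb Lh σ τ₀ ρ₀ θ x₀ y₀ idx k)

/-- The average of the values `f(x̃) + g(r̃)`, which bounds `f(x) + g(r)` by Jensen's inequality
and is an affine function of the random block updates. -/
noncomputable def averageValue (Pb : Problem p d) (Lh σ : Fin n → ℝ) (τ₀ ρ₀ : ℝ) (θ : ℕ → ℝ)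
    (x₀ : Block p) (y₀ : Block d) (idx : ℕ → Fin m × Fin n) : ℕ → ℝ :=
  average τ₀ θ fun k => Pb.auxValue (Pb.scaledRun Lh σ τ₀ ρ₀ θ x₀ y₀ idx k)

lemma run_strongParams (Pb : Problem p d) (Lh σ : Fin n → ℝ) {τ₀ c : ℝ} (hτ₀ : τ₀ ≠ 0)
    (hc : 0 < c) (ρ₀ : ℝ) (x₀ : Block p) (y₀ : Block d) (idx : ℕ → Fin m × Fin n) (k : ℕ) :
    Pb.run σ τ₀ (strongParams c τ₀ ρ₀ (LhSigma σ Lh) (Pb.Lbar σ)) x₀ y₀ idx k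
      = Pb.scaledRun Lh σ τ₀ ρ₀ (fun k => (k + c) / c) x₀ y₀ idx k := by
  induction k with
  | zero => rfl
  | succ k ih =>
    have : 0 < (k : ℝ) + c := by positivity
    have hτ : c * τ₀ / (k + c) = τ₀ / ((k + c) / c) := by field_simp
    have hρ : ρ₀ * τ₀ ^ 2 / (τ₀ / ((k + c) / c)) ^ 2 = ρ₀ * ((k + c) / c) ^ 2 := by field_simp
    rw [run, ih, scaledRun, scaledStep]
    simp only [strongParams, hτ, hρ]

section ScaledRun

variable (Pb : Problem p d) (Lh σ : Fin n → ℝ) (τ₀ ρ₀ : ℝ) (θ : ℕ → ℝ) (x₀ : Block p)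
  (y₀ : Block d) (idx : ℕ → Fin m × Fin n)

lemma scaledRun_x (k : ℕ) : (Pb.scaledRun Lh σ τ₀ ρ₀ θ x₀ y₀ idx k).x
    = average τ₀ θ (fun l => (Pb.scaledRun Lh σ τ₀ ρ₀ θ x₀ y₀ idx l).xt) k := by
  induction k with
  | zero => rfl
  | succ k ih => rw [average, ← ih]; rfl

lemma scaledRun_r (k : ℕ) : (Pb.scaledRun Lh σ τ₀ ρ₀ θ x₀ y₀ idx k).r
    = average τ₀ θ (fun l => (Pb.scaledRun Lh σ τ₀ ρ₀ θ x₀ y₀ idx l).rt) k := by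
  induction k with
  | zero => rfl
  | succ k ih => rw [average, ← ih]; rfl

end ScaledRun

namespace StrongSetting

variable {Pb : Problem p d} {Lh μf σ q : Fin n → ℝ} {μg qhat : Fin m → ℝ} {τ₀ ρ₀ : ℝ}
  (hS : Pb.StrongSetting Lh μf σ q μg qhat τ₀ ρ₀)
include hS

lemma scaledStep_xt_mem {θ : ℝ} (hθ : 0 < θ) (e : Fin m × Fin n) {s : State p d}
    (hs : s.xt ∈ edom Pb.fSum) : (Pb.scaledStep Lh σ τ₀ ρ₀ θ e s).xt ∈ edom Pb.fSum := by
  have hτ₀ := hS.τ₀_pos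
  have hρ₀ := hS.ρ₀_pos
  have hσ := hS.σ_pos e.2
  have hβ := hS.smooth_add_pos (ρ := ρ₀ * θ ^ 2) (by positivity)
  have hproper := component_proper hS.standing.f_proper
  rw [scaledStep, step_xt]
  refine setBlock_mem_edom_sum hS.standing.f_proper.2 hs ?_
  exact (isProx_blockProx hproper (component_closed hS.standing.f_proper hS.standing.f_closed)
    hS.μf_pos hS.f_strong hS.σ_pos hτ₀ (div_pos hτ₀ hθ) (one_div_pos.2 hβ) _ _ e.2).mem_edom
    (hproper e.2) (by positivity)

lemma scaledStep_rt_mem {θ : ℝ} (hθ : 0 < θ) (e : Fin m × Fin n) {s : State p d}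
    (hs : s.rt ∈ edom Pb.gSum) : (Pb.scaledStep Lh σ τ₀ ρ₀ θ e s).rt ∈ edom Pb.gSum := by
  have hτ₀ := hS.τ₀_pos
  have hρ₀ := hS.ρ₀_pos
  have hproper := component_proper hS.standing.g_proper
  rw [scaledStep, step_rt]
  refine setBlock_mem_edom_sum hS.standing.g_proper.2 hs ?_
  exact (isProx_blockProx hproper (component_closed hS.standing.g_proper hS.standing.g_closed)
    hS.μg_pos hS.g_strong (fun _ => one_pos) hτ₀ (div_pos hτ₀ hθ) (by positivity) _ _ e.1).mem_edom
    (hproper e.1) (by positivity)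

lemma feasible_scaledRun {θ : ℕ → ℝ} (hθ0 : 1 ≤ θ 0) (hθ : Monotone θ) {x₀ : Block p}
    (hx₀ : x₀ ∈ edom Pb.fSum) (hKx₀ : Pb.K x₀ ∈ edom Pb.gSum) (y₀ : Block d)
    (idx : ℕ → Fin m × Fin n) (k : ℕ) :
    Pb.Feasible (Pb.averageValue Lh σ τ₀ ρ₀ θ x₀ y₀ idx k)
      (Pb.scaledRun Lh σ τ₀ ρ₀ θ x₀ y₀ idx k) := by
  have hpos (k : ℕ) : 0 < θ k := one_pos.trans_le (hθ0.trans (hθ k.zero_le))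
  have hxt (k : ℕ) : (Pb.scaledRun Lh σ τ₀ ρ₀ θ x₀ y₀ idx k).xt ∈ edom Pb.fSum := by
    induction k with
    | zero => exact hx₀
    | succ k ih => exact hS.scaledStep_xt_mem (hpos k) _ ih
  have hrt (k : ℕ) : (Pb.scaledRun Lh σ τ₀ ρ₀ θ x₀ y₀ idx k).rt ∈ edom Pb.gSum := by
    induction k with
    | zero => exact hKx₀
    | succ k ih => exact hS.scaledStep_rt_mem (hpos k) _ ih
  have hfg : ConvexOn ℝ (edom Pb.fSum ×ˢ edom Pb.gSum) fun z => Pb.fR z.1 + Pb.gR z.2 :=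
    ((hS.standing.fR_convexOn.comp_linearMap (LinearMap.fst ℝ _ _)).subset (fun _ h => h.1)
      (hS.standing.fR_convexOn.1.prod hS.standing.gR_convexOn.1)).add
    ((hS.standing.gR_convexOn.comp_linearMap (LinearMap.snd ℝ _ _)).subset (fun _ h => h.2)
      (hS.standing.fR_convexOn.1.prod hS.standing.gR_convexOn.1))
  have ha (k : ℕ) : ((Pb.scaledRun Lh σ τ₀ ρ₀ θ x₀ y₀ idx k).xt,
      (Pb.scaledRun Lh σ τ₀ ρ₀ θ x₀ y₀ idx k).rt) ∈ edom Pb.fSum ×ˢ edom Pb.gSum :=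
    ⟨hxt k, hrt k⟩
  have hmem := average_mem hfg.1 hS.τ₀_pos hS.τ₀_le_one hθ0 hθ ha k
  have hle := le_average_of_convexOn hfg hS.τ₀_pos hS.τ₀_le_one hθ0 hθ ha k
  rw [average_prodMk, ← scaledRun_x, ← scaledRun_r] at hmem hle
  exact ⟨hxt k, hrt k, hmem.1, hmem.2, hle⟩

end StrongSetting

end Problem

section RandomRecursion

variable {Ω α S : Type*} {ξ : ℕ → Ω → α} {T : ℕ → α → S → S} {z₀ : S} {Z : ℕ → Ω → S}

lemma exists_eq_history (hZ0 : ∀ ω, Z 0 ω = z₀)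
    (hZ : ∀ k ω, Z (k + 1) ω = T k (ξ k ω) (Z k ω)) (k : ℕ) :
    ∃ G : (Finset.range k → α) → S, ∀ ω, Z k ω = G fun l => ξ l ω := by
  induction k with
  | zero => exact ⟨fun _ => z₀, hZ0⟩
  | succ k ih =>
    obtain ⟨G, hG⟩ := ih
    refine ⟨fun a => T k (a ⟨k, Finset.self_mem_range_succ k⟩)
      (G fun l => a ⟨l, Finset.range_subset_range.2 k.le_succ l.2⟩), fun ω => ?_⟩
    rw [hZ, hG]

variable [MeasurableSpace Ω] {P : Measure Ω} [IsProbabilityMeasure P] [MeasurableSpace α]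
  [MeasurableSingletonClass α]

lemma integrable_comp_recursion [Finite α] (hξ : ∀ k, Measurable (ξ k)) (hZ0 : ∀ ω, Z 0 ω = z₀)
    (hZ : ∀ k ω, Z (k + 1) ω = T k (ξ k ω) (Z k ω)) (Φ : S → ℝ) (k : ℕ) :
    Integrable (fun ω => Φ (Z k ω)) P := by
  obtain ⟨G, hG⟩ := exists_eq_history hZ0 hZ k
  simp only [hG]
  exact (Integrable.of_finite (f := fun a => Φ (G a))).comp_measurable
    (measurable_pi_lambda _ fun l : Finset.range k => hξ l)

lemma integral_comp_recursion_succ [Fintype α] (hξ : ∀ k, Measurable (ξ k))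
    (hind : iIndepFun ξ P) (hZ0 : ∀ ω, Z 0 ω = z₀)
    (hZ : ∀ k ω, Z (k + 1) ω = T k (ξ k ω) (Z k ω)) (Φ : S → ℝ) (k : ℕ) :
    ∫ ω, Φ (Z (k + 1) ω) ∂P
      = ∫ ω, ∑ a, P.real {ω | ξ k ω = a} * Φ (T k a (Z k ω)) ∂P := by
  obtain ⟨G, hG⟩ := exists_eq_history hZ0 hZ k
  have hhistory : Measurable fun ω (l : Finset.range k) => ξ l ω :=
    measurable_pi_lambda _ fun l => hξ l
  have hindep : IndepFun (fun ω (l : Finset.range k) => ξ l ω) (ξ k) P :=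
    (hind.indepFun_finset (Finset.range k) {k} (by simp) hξ).comp measurable_id
      (measurable_pi_apply (⟨k, Finset.mem_singleton_self k⟩ : ({k} : Finset ℕ)))
  have hprod := (indepFun_iff_map_prod_eq_prod_map_map hhistory.aemeasurable
    (hξ k).aemeasurable).1 hindep
  have := Measure.isProbabilityMeasure_map (μ := P) hhistory.aemeasurable
  have := Measure.isProbabilityMeasure_map (μ := P) (hξ k).aemeasurable
  calc ∫ ω, Φ (Z (k + 1) ω) ∂P
      = ∫ b, Φ (T k b.2 (G b.1)) ∂(P.map fun ω => (fun l : Finset.range k => ξ l ω, ξ k ω)) := by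
        rw [integral_map (hhistory.prodMk (hξ k)).aemeasurable
          (measurable_of_finite _).aestronglyMeasurable]
        simp only [hZ, hG]
    _ = ∫ h, ∫ a, Φ (T k a (G h)) ∂(P.map (ξ k)) ∂(P.map fun ω (l : Finset.range k) => ξ l ω) := by
        rw [hprod, integral_prod _ Integrable.of_finite]
    _ = ∫ ω, ∑ a, P.real {ω | ξ k ω = a} * Φ (T k a (Z k ω)) ∂P := by
        rw [integral_map hhistory.aemeasurable (measurable_of_finite _).aestronglyMeasurable]
        simp only [integral_fintype Integrable.of_finite, hG, smul_eq_mul,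
          map_measureReal_apply (hξ k) (measurableSet_singleton _)]
        rfl

end RandomRecursion

lemma tauZero_le_left {m n : ℕ} (qhat : Fin m → ℝ) (q : Fin n → ℝ) (i : Fin m) :
    tauZero qhat q ≤ qhat i :=
  (min_le_left _ _).trans (ciInf_le (Set.finite_range qhat).bddBelow i)

lemma tauZero_le_right {m n : ℕ} (qhat : Fin m → ℝ) (q : Fin n → ℝ) (j : Fin n) :
    tauZero qhat q ≤ q j :=
  (min_le_right _ _).trans (ciInf_le (Set.finite_range q).bddBelow j)

namespace IsSampling

variable {Ω : Type*} [MeasurableSpace Ω] {P : Measure Ω} {m n : ℕ}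
  {qhat : Fin m → ℝ} {q : Fin n → ℝ} {I : ℕ → Ω → Fin m} {J : ℕ → Ω → Fin n}
  (hIJ : IsSampling P qhat q I J)
include hIJ

lemma measureReal_eq (k : ℕ) (a : Fin m × Fin n) :
    P.real {ω | (I k ω, J k ω) = a} = qhat a.1 * q a.2 := by
  have hset : {ω | (I k ω, J k ω) = a} = I k ⁻¹' {a.1} ∩ J k ⁻¹' {a.2} := by
    ext ω
    simp [Prod.ext_iff]
  rw [hset, Measure.real, (hIJ.indep_pair k).measure_inter_preimage_eq_mul _ _
    (measurableSet_singleton _) (measurableSet_singleton _), ENNReal.toReal_mul,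
    ← hIJ.law_i k a.1, ← hIJ.law_j k a.2]
  rfl

lemma sum_qhat [IsProbabilityMeasure P] : ∑ i, qhat i = 1 := by
  simp only [← hIJ.law_i 0]
  exact (sum_measureReal_preimage_singleton _ fun i _ =>
    hIJ.meas_i 0 (measurableSet_singleton i)).trans (by simp)

lemma sum_q [IsProbabilityMeasure P] : ∑ j, q j = 1 := by
  simp only [← hIJ.law_j 0]
  exact (sum_measureReal_preimage_singleton _ fun j _ =>
    hIJ.meas_j 0 (measurableSet_singleton j)).trans (by simp)

lemma tauZero_nonneg : 0 ≤ tauZero qhat q :=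
  le_min (Real.iInf_nonneg fun i => hIJ.law_i 0 i ▸ measureReal_nonneg)
    (Real.iInf_nonneg fun j => hIJ.law_j 0 j ▸ measureReal_nonneg)

end IsSampling

section Rates

lemma not_summable_one_div_mul_log : ¬ Summable fun k : ℕ => 1 / ((k : ℝ) * Real.log k) := by
  rw [← summable_condensed_iff_of_eventually_nonneg]
  · have hcondensed : (fun k : ℕ =>
        (2 : ℝ) ^ k * (1 / (((2 ^ k : ℕ) : ℝ) * Real.log ((2 ^ k : ℕ) : ℝ))))
        = fun k : ℕ => (1 / Real.log 2) * (1 / (k : ℝ)) := by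
      funext k
      rw [Nat.cast_pow, Real.log_pow, Nat.cast_ofNat]
      field_simp
    rw [hcondensed, summable_mul_left_iff (one_div_pos.2 (Real.log_pos one_lt_two)).ne']
    exact Real.not_summable_one_div_natCast
  · exact Eventually.of_forall fun k =>
      one_div_nonneg.2 (mul_nonneg k.cast_nonneg (Real.log_natCast_nonneg k))
  · filter_upwards [eventually_ge_atTop 2] with k hk
    have hk2 : (2 : ℝ) ≤ k := mod_cast hk
    have hlog : 0 < Real.log k := Real.log_pos (by linarith)
    push_cast
    gcongr <;> linarith

lemma frequently_sq_mul_log_mul_lt {e : ℕ → ℝ} (hs : Summable fun k : ℕ => (k : ℝ) * e k) {ε : ℝ}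
    (hε : 0 < ε) : ∃ᶠ k : ℕ in atTop, (k : ℝ) ^ 2 * Real.log k * e k < ε := by
  by_contra hcon
  refine not_summable_one_div_mul_log
    (Summable.of_norm_bounded_eventually_nat (hs.mul_left (1 / ε)) ?_)
  filter_upwards [not_frequently.1 hcon, eventually_ge_atTop 2] with k hk hk2
  have hlog : 0 < Real.log k := Real.log_pos (mod_cast hk2)
  have : (0 : ℝ) < k := by positivity
  rw [Real.norm_of_nonneg (by positivity), div_le_iff₀ (by positivity),
    show 1 / ε * (k * e k) * (k * Real.log k) = (k : ℝ) ^ 2 * Real.log k * e k / ε by ring,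
    one_le_div hε]
  exact not_lt.1 hk

lemma sq_mul_mul_le_of_sq_mul_sq_mul_le {a r e v C s : ℝ} (ha : 0 < a) (hr : 1 ≤ r) (he : 0 ≤ e)
    (hC : 0 ≤ C) (hs : 0 ≤ s) (hs1 : s ≤ 1) (hv : v ≤ e + C / a * √e)
    (h : a ^ 2 * r ^ 2 * e ≤ s ^ 2) : a ^ 2 * r * v ≤ (1 + C) * s := by
  have hsqrt : a * r * √e ≤ s := by
    refine (pow_le_pow_iff_left₀ (by positivity) hs two_ne_zero).1 ?_
    rwa [mul_pow, mul_pow, Real.sq_sqrt he]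
  calc a ^ 2 * r * v ≤ a ^ 2 * r * (e + C / a * √e) := by gcongr
    _ = a ^ 2 * r * e + C * (a * r * √e) := by field_simp
    _ ≤ a ^ 2 * r ^ 2 * e + C * s := by gcongr; exact le_self_pow₀ hr two_ne_zero
    _ ≤ s ^ 2 + C * s := by gcongr
    _ ≤ (1 + C) * s := by nlinarith

lemma frequently_sq_mul_sqrt_log_mul_lt {v e : ℕ → ℝ} {C : ℝ} (hC : 0 ≤ C) (he : ∀ k, 0 ≤ e k)
    (hs : Summable fun k : ℕ => (k : ℝ) * e k)
    (hv : ∀ k : ℕ, 0 < k → v k ≤ e k + C / k * √(e k)) {ε : ℝ} (hε : 0 < ε) :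
    ∃ᶠ k : ℕ in atTop, (k : ℝ) ^ 2 * √(Real.log k) * v k < ε := by
  set s := min 1 (ε / (2 * (1 + C)))
  have hs_pos : 0 < s := lt_min one_pos (by positivity)
  have hs_lt : (1 + C) * s < ε :=
    calc (1 + C) * s ≤ (1 + C) * (ε / (2 * (1 + C))) := by gcongr; exact min_le_right _ _
      _ = ε / 2 := by field_simp
      _ < ε := half_lt_self hε
  refine ((frequently_sq_mul_log_mul_lt hs (sq_pos_of_pos hs_pos)).and_eventually
    (eventually_ge_atTop 3)).mono fun k ⟨hk, hk3⟩ => ?_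
  have hk3' : (3 : ℝ) ≤ k := mod_cast hk3
  have hlog : 1 ≤ Real.log k := by
    rw [Real.le_log_iff_exp_le (by linarith)]
    linarith [Real.exp_one_lt_d9]
  rw [← Real.sq_sqrt (zero_le_one.trans hlog)] at hk
  exact (sq_mul_mul_le_of_sq_mul_sq_mul_le (by linarith) (Real.one_le_sqrt.2 hlog) (he k) hC
    hs_pos.le (min_le_left _ _) (hv k (by omega)) hk.le).trans_lt hs_lt

lemma liminf_coe_eq_zero {u : ℕ → ℝ} (hu : ∀ k, 0 ≤ u k) (h : ∀ ε > 0, ∃ᶠ k in atTop, u k < ε) :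
    liminf (fun k => (u k : EReal)) atTop = 0 := by
  refine le_antisymm (le_of_forall_gt fun b hb => ?_)
    (le_liminf_of_le (h := Eventually.of_forall fun k => EReal.coe_nonneg.2 (hu k)))
  obtain ⟨ε, hε, hεb⟩ := EReal.lt_iff_exists_real_btwn.1 hb
  exact (liminf_le_of_frequently_le ((h ε (EReal.coe_pos.1 hε)).mono
    fun k hk => EReal.coe_le_coe hk.le)).trans_lt hεb

lemma smallOLiminf_one_div_iff {u w : ℕ → ℝ} :
    SmallOLiminf u (fun k => 1 / w k)
      ↔ liminf (fun k => ((w k * u k : ℝ) : EReal)) atTop = 0 := by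
  simp only [SmallOLiminf, div_div_eq_mul_div, div_one, mul_comm]

lemma summable_of_succ_add_le {a b : ℕ → ℝ} (ha : ∀ k, 0 ≤ a k) (hb : ∀ k, 0 ≤ b k)
    (h : ∀ k, a (k + 1) + b k ≤ a k) : Summable b := by
  have htelescope (N : ℕ) : a N + ∑ k ∈ Finset.range N, b k ≤ a 0 := by
    induction N with
    | zero => simp
    | succ N ih =>
      rw [Finset.sum_range_succ]
      linarith [h N]
  exact summable_of_sum_range_le hb fun N => by linarith [htelescope N, ha N]

end Rates

lemma integral_le_sqrt_integral_sq {Ω : Type*} [MeasurableSpace Ω] {P : Measure Ω}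
    [IsProbabilityMeasure P] {X : Ω → ℝ} (hX : Integrable X P)
    (hX2 : Integrable (fun ω => X ω ^ 2) P) : ∫ ω, X ω ∂P ≤ √(∫ ω, X ω ^ 2 ∂P) :=
  Real.le_sqrt_of_sq_le ((even_two.convexOn_pow).map_integral_le (by fun_prop) isClosed_univ
    (ae_of_all _ fun _ => Set.mem_univ _) hX hX2)

lemma add_mul_div_mul_sqrt_le {e E C κ θ : ℝ} (hθ : 0 < θ) (hC : 0 ≤ C) (hκ : 0 ≤ κ)
    (he : θ ^ 2 * e ≤ E) : e + C * (κ / θ * √e) ≤ (E + C * (κ * √E)) / θ ^ 2 := by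
  have hsqrt : θ * √e ≤ √E := by
    rw [← Real.sqrt_sq hθ.le, ← Real.sqrt_mul (sq_nonneg θ)]
    exact Real.sqrt_le_sqrt he
  calc e + C * (κ / θ * √e) = (θ ^ 2 * e + C * (κ * (θ * √e))) / θ ^ 2 := by field_simp
    _ ≤ (E + C * (κ * √E)) / θ ^ 2 := by gcongr

namespace Problem

variable {m n : ℕ} {p : Fin n → ℕ} {d : Fin m → ℕ}

lemma Standing.FR_le_of_mem_primalSol {Pb : Problem p d} {Lh : Fin n → ℝ} (hA : Pb.Standing Lh)
    {xs : Block p} (hxs : xs ∈ Pb.primalSol) {x : Block p} (hx : x ∈ edom Pb.fSum)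
    (hKx : Pb.K x ∈ edom Pb.gSum) : Pb.FR xs ≤ Pb.FR x := by
  rw [← EReal.coe_le_coe_iff, ← hA.Fstar_eq hxs, ← hA.F_eq hx hKx]
  exact iInf_le _ x

lemma Standing.FR_sub_le_lagrangianGap_add {Pb : Problem p d} {Lh : Fin n → ℝ}
    (hA : Pb.Standing Lh) {M : ℝ} (hLip : LipschitzAt M Pb.gSum (Pb.K '' edom Pb.fSum)) {ρ : ℝ}
    (hρ : 0 ≤ ρ) (xs : Block p) (ys : Block d) {v : ℝ} {s : State p d} (hs : Pb.Feasible v s) :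
    Pb.FR s.x - Pb.FR xs ≤ Pb.lagrangianGap ρ xs ys v s + (M + ‖ys‖) * ‖Pb.resid s‖ := by
  have hg : Pb.gR (Pb.K s.x) ≤ Pb.gR s.r + M * ‖Pb.resid s‖ := hA.gR_map_le hLip hs.x_mem hs.r_mem
  have hinner := neg_le_of_abs_le (abs_real_inner_le_norm ys (Pb.resid s))
  have hpenalty : 0 ≤ ρ / 2 * ‖Pb.resid s‖ ^ 2 := by positivity
  rw [FR, lagrangianGap]
  linarith [hs.le_value]

lemma IsMultiplier.norm_resid_sq_le {Pb : Problem p d} {xs : Block p} {ys : Block d}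
    (hys : Pb.IsMultiplier (Pb.FR xs) ys) {v : ℝ} {s : State p d} (hs : Pb.Feasible v s) {ρ : ℝ}
    (hρ : 0 < ρ) : ‖Pb.resid s‖ ^ 2 ≤ 2 / ρ * Pb.lagrangianGap ρ xs ys v s := by
  have hgap := hys.lagrangianGap_nonneg hs le_rfl
  rw [div_mul_eq_mul_div, le_div_iff₀ hρ, Pb.lagrangianGap_eq_add]
  linarith

lemma Standing.strongSetting {Pb : Problem p d} {Lh μf σ q : Fin n → ℝ} {μg qhat : Fin m → ℝ}
    (hA : Pb.Standing Lh) (hμf : ∀ j, 0 < μf j) (hf : ∀ j, EStrongConvex (μf j) (Pb.f j))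
    (hμg : ∀ i, 0 < μg i) (hg : ∀ i, EStrongConvex (μg i) (Pb.g i)) (hσ : ∀ j, 0 < σ j)
    (hβ : 0 < LhSigma σ Lh + Pb.Lbar σ) {Ω : Type*} [MeasurableSpace Ω] {P : Measure Ω}
    [IsProbabilityMeasure P] {I : ℕ → Ω → Fin m} {J : ℕ → Ω → Fin n}
    (hIJ : IsSampling P qhat q I J) {c : ℝ} (hcτ : 2 < c * tauZero qhat q) {ρ₀ : ℝ}
    (hρ₀ : 0 < ρ₀) (hρg : ρ₀ ≤ muMin μg / 8) (hρf : ρ₀ * Pb.Lbar σ ≤ muSigma σ μf / 8) :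
    Pb.StrongSetting Lh μf σ q μg qhat (tauZero qhat q) ρ₀ where
  standing := hA
  μf_pos := hμf
  f_strong := hf
  μg_pos := hμg
  g_strong := hg
  σ_pos := hσ
  smooth_pos := hβ
  q_sum := hIJ.sum_q
  qhat_sum := hIJ.sum_qhat
  τ₀_pos := hIJ.tauZero_nonneg.lt_of_ne' (right_ne_zero_of_mul (two_pos.trans hcτ).ne')
  τ₀_le_q := tauZero_le_right qhat q
  τ₀_le_qhat := tauZero_le_left qhat q
  ρ₀_pos := hρ₀
  ρ₀_le := hρg
  ρ₀_mul_le := hρf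

namespace StrongSetting

variable {Pb : Problem p d} {Lh μf σ q : Fin n → ℝ} {μg qhat : Fin m → ℝ} {τ₀ ρ₀ : ℝ}

lemma sq_mul_lagrangianGap_le_lyapunov (hS : Pb.StrongSetting Lh μf σ q μg qhat τ₀ ρ₀) {θ : ℝ}
    (hθ : 0 ≤ θ) (xs : Block p) (ys : Block d) (v : ℝ) (s : State p d) :
    θ ^ 2 * Pb.lagrangianGap (ρ₀ * θ ^ 2) xs ys v s
      ≤ Pb.lyapunov Lh μf σ q μg qhat τ₀ ρ₀ θ xs ys v s := by
  have hτ₀ := hS.τ₀_pos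
  have hρ₀ := hS.ρ₀_pos
  have hLh := hS.LhSigma_nonneg
  have hLbar := Pb.Lbar_nonneg σ
  have hμσ := hS.muSigma_nonneg
  have hμg : 0 ≤ muMin μg := Real.iInf_nonneg fun i => (hS.μg_pos i).le
  have hX := wnormSq_nonneg (fun j => (div_pos (hS.σ_pos j) (hS.q_pos j)).le) (s.xt - xs)
  have hR := wnormSq_nonneg (fun i => (one_div_pos.2 (hS.qhat_pos i)).le) (s.rt - Pb.K xs)
  rw [lyapunov, add_assoc, add_assoc]
  exact le_add_of_nonneg_right (by positivity)

lemma lyapunov_initial_le (hS : Pb.StrongSetting Lh μf σ q μg qhat (tauZero qhat q) ρ₀)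
    {θ : ℝ} (hθ : 0 ≤ θ) (hθ1 : θ ≤ 1) {x₀ xs : Block p} (hx₀ : x₀ ∈ edom Pb.fSum)
    (hKx₀ : Pb.K x₀ ∈ edom Pb.gSum) (hxs : xs ∈ Pb.primalSol) (y₀ ys : Block d) :
    Pb.lyapunov Lh μf σ q μg qhat (tauZero qhat q) ρ₀ θ xs ys (Pb.fR x₀ + Pb.gR (Pb.K x₀))
        ⟨x₀, x₀, Pb.K x₀, Pb.K x₀, y₀, y₀⟩
      ≤ Pb.E0sq σ Lh μf μg qhat q ρ₀ x₀ xs y₀ ys := by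
  have hτ₀ := hS.τ₀_pos
  have hρ₀ := hS.ρ₀_pos
  have hLbar := Pb.Lbar_nonneg σ
  have hμσ := hS.muSigma_nonneg
  have hμg : 0 ≤ muMin μg := Real.iInf_nonneg fun i => (hS.μg_pos i).le
  have hX := wnormSq_nonneg (fun j => (div_pos (hS.σ_pos j) (hS.q_pos j)).le) (x₀ - xs)
  have hR := wnormSq_nonneg (fun i => (one_div_pos.2 (hS.qhat_pos i)).le) (Pb.K x₀ - Pb.K xs)
  have hθsq : θ ^ 2 ≤ 1 := pow_le_one₀ hθ hθ1
  have hgap := sub_nonneg.2 (hS.standing.FR_le_of_mem_primalSol hxs hx₀ hKx₀)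
  have hinitial (ρ : ℝ) : Pb.lagrangianGap ρ xs ys (Pb.fR x₀ + Pb.gR (Pb.K x₀))
      ⟨x₀, x₀, Pb.K x₀, Pb.K x₀, y₀, y₀⟩ = Pb.FR x₀ - Pb.FR xs := by
    simp only [lagrangianGap, FR, resid, sub_self, inner_zero_right, norm_zero]
    ring
  have hscaleX : LhSigma σ Lh + 4 * (ρ₀ * Pb.Lbar σ) * θ ^ 2 + muSigma σ μf * θ
      ≤ LhSigma σ Lh + 4 * ρ₀ * Pb.Lbar σ + muSigma σ μf := by
    have hcoupling := mul_le_of_le_one_right (by positivity : 0 ≤ 4 * (ρ₀ * Pb.Lbar σ)) hθsq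
    linarith [mul_le_of_le_one_right hμσ hθ1]
  have hscaleR : 4 * ρ₀ * θ ^ 2 + muMin μg * θ ≤ 4 * ρ₀ + muMin μg :=
    add_le_add (mul_le_of_le_one_right (by positivity) hθsq) (mul_le_of_le_one_right hμg hθ1)
  rw [lyapunov, hinitial, E0sq, hS.standing.F_eq hx₀ hKx₀, hS.standing.Fstar_eq hxs,
    EReal.toReal_coe, EReal.toReal_coe, map_sub, mul_comm (LhSigma σ Lh + _ + _),
    mul_div_right_comm, mul_div_right_comm]
  gcongr ?_ + _ + _ * ?_ * _ + _ * ?_ * _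
  exact mul_le_of_le_one_left hgap hθsq

end StrongSetting

/-- The `k`-th state of the run with the scales `(k + c) / c`, preceded by its average value. -/
noncomputable def valuedRun (Pb : Problem p d) (Lh σ : Fin n → ℝ) (τ₀ ρ₀ c : ℝ) (x₀ : Block p)
    (y₀ : Block d) (idx : ℕ → Fin m × Fin n) (k : ℕ) : ℝ × State p d :=
  (Pb.averageValue Lh σ τ₀ ρ₀ (fun k => (k + c) / c) x₀ y₀ idx k,
    Pb.scaledRun Lh σ τ₀ ρ₀ (fun k => (k + c) / c) x₀ y₀ idx k)

/-- One iteration at the scale `θ` as a map on states preceded by their average value. -/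
noncomputable def valuedStep (Pb : Problem p d) (Lh σ : Fin n → ℝ) (τ₀ ρ₀ θ : ℝ)
    (e : Fin m × Fin n) (z : ℝ × State p d) : ℝ × State p d :=
  (extrapolate τ₀ (τ₀ / θ) z.1 (Pb.auxValue z.2)
    (Pb.auxValue (Pb.scaledStep Lh σ τ₀ ρ₀ θ e z.2)), Pb.scaledStep Lh σ τ₀ ρ₀ θ e z.2)

lemma valuedRun_zero (Pb : Problem p d) (Lh σ : Fin n → ℝ) (τ₀ ρ₀ c : ℝ) (x₀ : Block p)
    (y₀ : Block d) (idx : ℕ → Fin m × Fin n) :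
    Pb.valuedRun Lh σ τ₀ ρ₀ c x₀ y₀ idx 0
      = (Pb.fR x₀ + Pb.gR (Pb.K x₀), ⟨x₀, x₀, Pb.K x₀, Pb.K x₀, y₀, y₀⟩) := rfl

lemma valuedRun_succ (Pb : Problem p d) (Lh σ : Fin n → ℝ) (τ₀ ρ₀ c : ℝ) (x₀ : Block p)
    (y₀ : Block d) (idx : ℕ → Fin m × Fin n) (k : ℕ) :
    Pb.valuedRun Lh σ τ₀ ρ₀ c x₀ y₀ idx (k + 1)
      = Pb.valuedStep Lh σ τ₀ ρ₀ ((k + c) / c) (idx k)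
          (Pb.valuedRun Lh σ τ₀ ρ₀ c x₀ y₀ idx k) := rfl

lemma valuedRun_snd (Pb : Problem p d) (Lh σ : Fin n → ℝ) {τ₀ c : ℝ} (hτ₀ : τ₀ ≠ 0) (hc : 0 < c)
    (ρ₀ : ℝ) (x₀ : Block p) (y₀ : Block d) (idx : ℕ → Fin m × Fin n) (k : ℕ) :
    (Pb.valuedRun Lh σ τ₀ ρ₀ c x₀ y₀ idx k).2
      = Pb.run σ τ₀ (strongParams c τ₀ ρ₀ (LhSigma σ Lh) (Pb.Lbar σ)) x₀ y₀ idx k :=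
  (Pb.run_strongParams Lh σ hτ₀ hc ρ₀ x₀ y₀ idx k).symm

variable {Ω : Type*} [MeasurableSpace Ω]

/-- The expectation of the augmented Lagrangian gap after `k` iterations of a random run `Z`. -/
noncomputable def expectedGap (Pb : Problem p d) (ρ₀ c : ℝ) (xs : Block p) (ys : Block d)
    (P : Measure Ω) (Z : ℕ → Ω → ℝ × State p d) (k : ℕ) : ℝ :=
  ∫ ω, Pb.lagrangianGap (ρ₀ * ((k + c - 1) / c) ^ 2) xs ys (Z k ω).1 (Z k ω).2 ∂P

/-- The expectation of the Lyapunov function after `k` iterations of a random run `Z`; its scale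
`(k + c - 1) / c` is the one of the preceding iteration. -/
noncomputable def expectedLyapunov (Pb : Problem p d) (Lh μf σ q : Fin n → ℝ)
    (μg qhat : Fin m → ℝ) (τ₀ ρ₀ c : ℝ) (xs : Block p) (ys : Block d) (P : Measure Ω)
    (Z : ℕ → Ω → ℝ × State p d) (k : ℕ) : ℝ :=
  ∫ ω, Pb.lyapunov Lh μf σ q μg qhat τ₀ ρ₀ ((k + c - 1) / c) xs ys (Z k ω).1 (Z k ω).2 ∂P

lemma expectedGap_nonneg {Pb : Problem p d} {ρ₀ : ℝ} (hρ₀ : 0 ≤ ρ₀) (c : ℝ) {xs : Block p}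
    {ys : Block d} (P : Measure Ω) (hys : Pb.IsMultiplier (Pb.FR xs) ys)
    {Z : ℕ → Ω → ℝ × State p d} (hfeas : ∀ k ω, Pb.Feasible (Z k ω).1 (Z k ω).2) (k : ℕ) :
    0 ≤ Pb.expectedGap ρ₀ c xs ys P Z k :=
  integral_nonneg fun ω => hys.lagrangianGap_nonneg (hfeas k ω) (mul_nonneg hρ₀ (sq_nonneg _))

lemma StrongSetting.expectedLyapunov_zero_le {Pb : Problem p d} {Lh μf σ q : Fin n → ℝ}
    {μg qhat : Fin m → ℝ} {ρ₀ : ℝ}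
    (hS : Pb.StrongSetting Lh μf σ q μg qhat (tauZero qhat q) ρ₀) {c : ℝ} (hc : 1 ≤ c)
    {x₀ xs : Block p} (hx₀ : x₀ ∈ edom Pb.fSum) (hKx₀ : Pb.K x₀ ∈ edom Pb.gSum)
    (hxs : xs ∈ Pb.primalSol) (y₀ ys : Block d) (P : Measure Ω) [IsProbabilityMeasure P]
    {Z : ℕ → Ω → ℝ × State p d}
    (hZ0 : ∀ ω, Z 0 ω = (Pb.fR x₀ + Pb.gR (Pb.K x₀), ⟨x₀, x₀, Pb.K x₀, Pb.K x₀, y₀, y₀⟩)) :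
    Pb.expectedLyapunov Lh μf σ q μg qhat (tauZero qhat q) ρ₀ c xs ys P Z 0
      ≤ Pb.E0sq σ Lh μf μg qhat q ρ₀ x₀ xs y₀ ys := by
  have hc0 : 0 < c := one_pos.trans_le hc
  simp only [expectedLyapunov, hZ0, integral_const, probReal_univ, one_smul,
    Nat.cast_zero, zero_add]
  exact hS.lyapunov_initial_le (div_nonneg (sub_nonneg.2 hc) hc0.le)
    ((div_le_one hc0).2 (sub_le_self c zero_le_one)) hx₀ hKx₀ hxs y₀ ys

section RandomRun

variable {Pb : Problem p d} {Lh μf σ q : Fin n → ℝ} {μg qhat : Fin m → ℝ} {τ₀ ρ₀ c : ℝ}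
  {P : Measure Ω} [IsProbabilityMeasure P] {I : ℕ → Ω → Fin m} {J : ℕ → Ω → Fin n}
  {x₀ xs : Block p} {y₀ ys : Block d} {Z : ℕ → Ω → ℝ × State p d}

lemma integrable_comp_valuedRun (hIJ : IsSampling P qhat q I J)
    (hZ : ∀ k ω, Z k ω = Pb.valuedRun Lh σ τ₀ ρ₀ c x₀ y₀ (fun l => (I l ω, J l ω)) k)
    (Φ : ℝ × State p d → ℝ) (k : ℕ) : Integrable (fun ω => Φ (Z k ω)) P :=
  integrable_comp_recursion (T := fun k => Pb.valuedStep Lh σ τ₀ ρ₀ ((k + c) / c))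
    (fun k => (hIJ.meas_i k).prodMk (hIJ.meas_j k))
    (fun ω => (hZ 0 ω).trans (valuedRun_zero ..))
    (fun k ω => by rw [hZ, hZ, valuedRun_succ]) Φ k

lemma integral_comp_valuedRun_succ (hIJ : IsSampling P qhat q I J)
    (hZ : ∀ k ω, Z k ω = Pb.valuedRun Lh σ τ₀ ρ₀ c x₀ y₀ (fun l => (I l ω, J l ω)) k)
    (Φ : ℝ × State p d → ℝ) (k : ℕ) :
    ∫ ω, Φ (Z (k + 1) ω) ∂P = ∫ ω, ∑ e : Fin m × Fin n,
      qhat e.1 * q e.2 * Φ (Pb.valuedStep Lh σ τ₀ ρ₀ ((k + c) / c) e (Z k ω)) ∂P := by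
  have hsucc := integral_comp_recursion_succ
    (T := fun k => Pb.valuedStep Lh σ τ₀ ρ₀ ((k + c) / c))
    (fun k => (hIJ.meas_i k).prodMk (hIJ.meas_j k)) hIJ.indep_time
    (fun ω => (hZ 0 ω).trans (valuedRun_zero ..))
    (fun k ω => by rw [hZ, hZ, valuedRun_succ]) Φ k
  simpa only [hIJ.measureReal_eq] using hsucc

namespace StrongSetting

variable (hS : Pb.StrongSetting Lh μf σ q μg qhat τ₀ ρ₀)
include hS

lemma feasible_valuedRun (hc : 0 < c) (hx₀ : x₀ ∈ edom Pb.fSum) (hKx₀ : Pb.K x₀ ∈ edom Pb.gSum)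
    (y₀ : Block d) (idx : ℕ → Fin m × Fin n) (k : ℕ) :
    Pb.Feasible (Pb.valuedRun Lh σ τ₀ ρ₀ c x₀ y₀ idx k).1
      (Pb.valuedRun Lh σ τ₀ ρ₀ c x₀ y₀ idx k).2 := by
  refine hS.feasible_scaledRun ?_ (fun k l hkl => ?_) hx₀ hKx₀ y₀ idx k
  · rw [Nat.cast_zero, zero_add, div_self hc.ne']
  · gcongr

lemma one_lt_of_two_le_mul (hcτ : 2 ≤ c * τ₀) : 1 < c := by
  nlinarith [hS.τ₀_pos, hS.τ₀_le_one]

lemma sum_lyapunov_valuedStep_add_le (hcτ : 2 ≤ c * τ₀) {xs : Block p}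
    (hxs : xs ∈ edom Pb.fSum) (hKxs : Pb.K xs ∈ edom Pb.gSum)
    (hys : Pb.IsMultiplier (Pb.FR xs) ys) (k : ℕ) {z : ℝ × State p d}
    (hz : Pb.Feasible z.1 z.2) :
    ∑ e : Fin m × Fin n, qhat e.1 * q e.2 * Pb.lyapunov Lh μf σ q μg qhat τ₀ ρ₀ ((k + c) / c) xs ys
        (Pb.valuedStep Lh σ τ₀ ρ₀ ((k + c) / c) e z).1
        (Pb.valuedStep Lh σ τ₀ ρ₀ ((k + c) / c) e z).2
      + (τ₀ - 2 * (1 / c)) * ((k + c) / c)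
        * Pb.lagrangianGap (ρ₀ * ((k + c - 1) / c) ^ 2) xs ys z.1 z.2
      ≤ Pb.lyapunov Lh μf σ q μg qhat τ₀ ρ₀ ((k + c - 1) / c) xs ys z.1 z.2 := by
  have hc : 0 < c := one_pos.trans (hS.one_lt_of_two_le_mul hcτ)
  have hθ : 1 ≤ (k + c) / c := (one_le_div hc).2 (le_add_of_nonneg_left k.cast_nonneg)
  have hδτ : 2 * (1 / c) ≤ τ₀ := by rwa [mul_one_div, div_le_iff₀' hc]
  rw [sub_div (k + c)]
  exact hS.sum_lyapunov_scaledStep_add_le hθ (one_div_nonneg.2 hc.le) hδτ hxs hKxs hys hz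

variable (hIJ : IsSampling P qhat q I J)
  (hZ : ∀ k ω, Z k ω = Pb.valuedRun Lh σ τ₀ ρ₀ c x₀ y₀ (fun l => (I l ω, J l ω)) k)
include hIJ hZ

lemma sq_mul_expectedGap_le_expectedLyapunov (hc : 1 ≤ c) (xs : Block p) (ys : Block d) (k : ℕ) :
    ((k + c - 1) / c) ^ 2 * Pb.expectedGap ρ₀ c xs ys P Z k
      ≤ Pb.expectedLyapunov Lh μf σ q μg qhat τ₀ ρ₀ c xs ys P Z k := by
  have hθ : 0 ≤ (k + c - 1) / c := by
    have : (0 : ℝ) ≤ k := k.cast_nonneg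
    exact div_nonneg (by linarith) (by linarith)
  rw [expectedGap, ← integral_const_mul]
  exact integral_mono
    (integrable_comp_valuedRun hIJ hZ (fun z => _ * Pb.lagrangianGap _ xs ys z.1 z.2) k)
    (integrable_comp_valuedRun hIJ hZ (fun z => Pb.lyapunov _ _ _ _ _ _ _ _ _ _ _ z.1 z.2) k)
    fun ω => hS.sq_mul_lagrangianGap_le_lyapunov hθ xs ys _ _

variable (hfeas : ∀ k ω, Pb.Feasible (Z k ω).1 (Z k ω).2) (hcτ : 2 ≤ c * τ₀)
  (hxs : xs ∈ edom Pb.fSum) (hKxs : Pb.K xs ∈ edom Pb.gSum) (hys : Pb.IsMultiplier (Pb.FR xs) ys)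
include hfeas

section Multiplier

include hys

include hcτ hxs hKxs in
lemma expectedLyapunov_succ_add_le (k : ℕ) :
    Pb.expectedLyapunov Lh μf σ q μg qhat τ₀ ρ₀ c xs ys P Z (k + 1)
        + (τ₀ - 2 * (1 / c)) * ((k + c) / c) * Pb.expectedGap ρ₀ c xs ys P Z k
      ≤ Pb.expectedLyapunov Lh μf σ q μg qhat τ₀ ρ₀ c xs ys P Z k := by
  have hscale : ((k + 1 : ℕ) + c - 1) / c = (k + c) / c := by push_cast; ring
  let next (z : ℝ × State p d) : ℝ := ∑ e : Fin m × Fin n, qhat e.1 * q e.2 *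
    Pb.lyapunov Lh μf σ q μg qhat τ₀ ρ₀ ((k + c) / c) xs ys
      (Pb.valuedStep Lh σ τ₀ ρ₀ ((k + c) / c) e z).1
      (Pb.valuedStep Lh σ τ₀ ρ₀ ((k + c) / c) e z).2
  let gain (z : ℝ × State p d) : ℝ := (τ₀ - 2 * (1 / c)) * ((k + c) / c) *
    Pb.lagrangianGap (ρ₀ * ((k + c - 1) / c) ^ 2) xs ys z.1 z.2
  have hnext := integrable_comp_valuedRun hIJ hZ next k
  have hgain := integrable_comp_valuedRun hIJ hZ gain k
  rw [expectedLyapunov, expectedLyapunov, expectedGap, hscale, integral_comp_valuedRun_succ hIJ hZ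
    (fun z => Pb.lyapunov Lh μf σ q μg qhat τ₀ ρ₀ ((k + c) / c) xs ys z.1 z.2),
    ← integral_const_mul]
  refine (integral_add hnext hgain).symm.trans_le (integral_mono (hnext.add hgain)
    (integrable_comp_valuedRun hIJ hZ (fun z => Pb.lyapunov _ _ _ _ _ _ _ _ _ _ _ z.1 z.2) k)
    fun ω => hS.sum_lyapunov_valuedStep_add_le hcτ hxs hKxs hys k (hfeas k ω))

include hcτ hxs hKxs in
lemma expectedLyapunov_le (k : ℕ) :
    Pb.expectedLyapunov Lh μf σ q μg qhat τ₀ ρ₀ c xs ys P Z k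
      ≤ Pb.expectedLyapunov Lh μf σ q μg qhat τ₀ ρ₀ c xs ys P Z 0 := by
  refine antitone_nat_of_succ_le (fun k => ?_) k.zero_le
  have hc := hS.one_lt_of_two_le_mul hcτ
  have hδτ : 0 ≤ τ₀ - 2 * (1 / c) := by
    rwa [sub_nonneg, mul_one_div, div_le_iff₀' (one_pos.trans hc)]
  have hgain := expectedGap_nonneg hS.ρ₀_pos.le c P hys hfeas k
  exact (le_add_of_nonneg_right (by positivity)).trans
    (hS.expectedLyapunov_succ_add_le hIJ hZ hfeas hcτ hxs hKxs hys k)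

include hxs hKxs in
lemma summable_mul_expectedGap (hcτ : 2 < c * τ₀) :
    Summable fun k : ℕ => (k : ℝ) * Pb.expectedGap ρ₀ c xs ys P Z k := by
  have hc : 0 < c := one_pos.trans (hS.one_lt_of_two_le_mul hcτ.le)
  have hδτ : 0 < τ₀ - 2 * (1 / c) := by
    rwa [sub_pos, mul_one_div, div_lt_iff₀' hc]
  have he := expectedGap_nonneg hS.ρ₀_pos.le c P hys hfeas
  have hgain : Summable fun k : ℕ =>
      (τ₀ - 2 * (1 / c)) * ((k + c) / c) * Pb.expectedGap ρ₀ c xs ys P Z k :=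
    summable_of_succ_add_le
      (fun k => (mul_nonneg (sq_nonneg _) (he k)).trans
        (hS.sq_mul_expectedGap_le_expectedLyapunov hIJ hZ (hS.one_lt_of_two_le_mul hcτ.le).le
          xs ys k))
      (fun k => mul_nonneg (by positivity) (he k))
      (hS.expectedLyapunov_succ_add_le hIJ hZ hfeas hcτ.le hxs hKxs hys)
  refine .of_nonneg_of_le (fun k => mul_nonneg k.cast_nonneg (he k)) (fun k => ?_)
    (hgain.mul_left (c / (τ₀ - 2 * (1 / c))))
  calc k * Pb.expectedGap ρ₀ c xs ys P Z k
      ≤ (k + c) * Pb.expectedGap ρ₀ c xs ys P Z k :=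
        mul_le_mul_of_nonneg_right (le_add_of_nonneg_right hc.le) (he k)
    _ = c / (τ₀ - 2 * (1 / c))
          * ((τ₀ - 2 * (1 / c)) * ((k + c) / c) * Pb.expectedGap ρ₀ c xs ys P Z k) := by
        generalize τ₀ - 2 * (1 / c) = δ at hδτ ⊢
        field_simp

lemma integral_norm_resid_le (hc : 1 < c) (k : ℕ) :
    ∫ ω, ‖Pb.resid (Z k ω).2‖ ∂P
      ≤ √(2 / ρ₀) / ((k + c - 1) / c) * √(Pb.expectedGap ρ₀ c xs ys P Z k) := by
  have hθ : 0 < (k + c - 1) / c :=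
    div_pos (by linarith [k.cast_nonneg (α := ℝ)]) (one_pos.trans hc)
  have hρ₀ := hS.ρ₀_pos
  have hintegrable := integrable_comp_valuedRun hIJ hZ
  have hsq : ∫ ω, ‖Pb.resid (Z k ω).2‖ ^ 2 ∂P
      ≤ 2 / (ρ₀ * ((k + c - 1) / c) ^ 2) * Pb.expectedGap ρ₀ c xs ys P Z k := by
    rw [expectedGap, ← integral_const_mul]
    exact integral_mono (hintegrable (fun z => ‖Pb.resid z.2‖ ^ 2) k)
      (hintegrable (fun z => _ * Pb.lagrangianGap _ xs ys z.1 z.2) k)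
      fun ω => hys.norm_resid_sq_le (hfeas k ω) (by positivity)
  calc ∫ ω, ‖Pb.resid (Z k ω).2‖ ∂P ≤ √(∫ ω, ‖Pb.resid (Z k ω).2‖ ^ 2 ∂P) :=
        integral_le_sqrt_integral_sq (hintegrable (fun z => ‖Pb.resid z.2‖) k)
          (hintegrable (fun z => ‖Pb.resid z.2‖ ^ 2) k)
    _ ≤ √(2 / (ρ₀ * ((k + c - 1) / c) ^ 2) * Pb.expectedGap ρ₀ c xs ys P Z k) :=
        Real.sqrt_le_sqrt hsq
    _ = √(2 / ρ₀) / ((k + c - 1) / c) * √(Pb.expectedGap ρ₀ c xs ys P Z k) := by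
        rw [Real.sqrt_mul (by positivity), ← div_div, Real.sqrt_div (by positivity),
          Real.sqrt_sq hθ.le]

lemma integral_FR_sub_le {M : ℝ} (hM : 0 ≤ M)
    (hLip : LipschitzAt M Pb.gSum (Pb.K '' edom Pb.fSum)) (hc : 1 < c) (k : ℕ) :
    ∫ ω, (Pb.FR (Z k ω).2.x - Pb.FR xs) ∂P ≤ Pb.expectedGap ρ₀ c xs ys P Z k
      + (M + ‖ys‖)
        * (√(2 / ρ₀) / ((k + c - 1) / c) * √(Pb.expectedGap ρ₀ c xs ys P Z k)) := by
  have hintegrable := integrable_comp_valuedRun hIJ hZ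
  have hgap := hintegrable (fun z => Pb.lagrangianGap (ρ₀ * ((k + c - 1) / c) ^ 2) xs ys z.1 z.2) k
  have hresid := hintegrable (fun z => (M + ‖ys‖) * ‖Pb.resid z.2‖) k
  calc ∫ ω, (Pb.FR (Z k ω).2.x - Pb.FR xs) ∂P
      ≤ ∫ ω, (Pb.lagrangianGap (ρ₀ * ((k + c - 1) / c) ^ 2) xs ys (Z k ω).1 (Z k ω).2
          + (M + ‖ys‖) * ‖Pb.resid (Z k ω).2‖) ∂P :=
        integral_mono (hintegrable (fun z => Pb.FR z.2.x - Pb.FR xs) k) (hgap.add hresid) fun ω =>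
          hS.standing.FR_sub_le_lagrangianGap_add hLip
            (mul_nonneg hS.ρ₀_pos.le (sq_nonneg _)) xs ys (hfeas k ω)
    _ = Pb.expectedGap ρ₀ c xs ys P Z k + (M + ‖ys‖) * ∫ ω, ‖Pb.resid (Z k ω).2‖ ∂P := by
        rw [integral_add hgap hresid, integral_const_mul, expectedGap]
    _ ≤ _ := by
        gcongr
        exact hS.integral_norm_resid_le hIJ hZ hfeas hys hc k

include hxs hKxs in
lemma integral_FR_sub_le_div_sq {M : ℝ} (hM : 0 ≤ M)
    (hLip : LipschitzAt M Pb.gSum (Pb.K '' edom Pb.fSum)) (hcτ : 2 ≤ c * τ₀) {E : ℝ}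
    (hE : Pb.expectedLyapunov Lh μf σ q μg qhat τ₀ ρ₀ c xs ys P Z 0 ≤ E) (k : ℕ) :
    ∫ ω, (Pb.FR (Z k ω).2.x - Pb.FR xs) ∂P
      ≤ (c ^ 2 * E + c ^ 2 * (M + ‖ys‖) * √E * √(2 / ρ₀)) / (k + c - 1) ^ 2 := by
  have hc := hS.one_lt_of_two_le_mul hcτ
  have hpos : 0 < k + c - 1 := by linarith [k.cast_nonneg (α := ℝ)]
  have hgap : ((k + c - 1) / c) ^ 2 * Pb.expectedGap ρ₀ c xs ys P Z k ≤ E :=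
    (hS.sq_mul_expectedGap_le_expectedLyapunov hIJ hZ hc.le xs ys k).trans
      ((hS.expectedLyapunov_le hIJ hZ hfeas hcτ hxs hKxs hys k).trans hE)
  calc ∫ ω, (Pb.FR (Z k ω).2.x - Pb.FR xs) ∂P
      ≤ _ := hS.integral_FR_sub_le hIJ hZ hfeas hys hM hLip hc k
    _ ≤ (E + (M + ‖ys‖) * (√(2 / ρ₀) * √E)) / ((k + c - 1) / c) ^ 2 :=
        add_mul_div_mul_sqrt_le (div_pos hpos (one_pos.trans hc)) (by positivity)
          (Real.sqrt_nonneg _) hgap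
    _ = _ := by field_simp

end Multiplier

lemma liminf_integral_FR_sub_Fstar_eq_zero {M : ℝ} (hM : 0 ≤ M)
    (hLip : LipschitzAt M Pb.gSum (Pb.K '' edom Pb.fSum)) (hcτ : 2 < c * τ₀) :
    liminf (fun k : ℕ => (((k : ℝ) ^ 2 * √(Real.log k)
      * ∫ ω, (Pb.FR (Z k ω).2.x - Pb.Fstar.toReal) ∂P : ℝ) : EReal)) atTop = 0 := by
  obtain ⟨xs, hxs⟩ := hS.standing.sol_nonempty
  obtain ⟨ys, hys⟩ := hS.standing.exists_isMultiplier hxs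
  obtain ⟨hdom, hKdom⟩ := hS.standing.mem_edom_of_mem_primalSol hxs
  rw [hS.standing.Fstar_eq hxs, EReal.toReal_coe]
  have hc := hS.one_lt_of_two_le_mul hcτ.le
  refine liminf_coe_eq_zero (fun k => mul_nonneg (by positivity)
    (integral_nonneg fun ω => sub_nonneg.2 (hS.standing.FR_le_of_mem_primalSol hxs
      (hfeas k ω).x_mem (hS.standing.map_mem_edom hLip (hfeas k ω).x_mem)))) fun ε hε => ?_
  refine frequently_sq_mul_sqrt_log_mul_lt (C := (M + ‖ys‖) * (√(2 / ρ₀) * c)) (by positivity)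
    (expectedGap_nonneg hS.ρ₀_pos.le c P hys hfeas)
    (hS.summable_mul_expectedGap hIJ hZ hfeas hdom hKdom hys hcτ) (fun k hk => ?_) hε
  have : (0 : ℝ) < k := mod_cast hk
  calc ∫ ω, (Pb.FR (Z k ω).2.x - Pb.FR xs) ∂P
      ≤ _ := hS.integral_FR_sub_le hIJ hZ hfeas hys hM hLip hc k
    _ ≤ Pb.expectedGap ρ₀ c xs ys P Z k
        + (M + ‖ys‖) * (√(2 / ρ₀) / (k / c) * √(Pb.expectedGap ρ₀ c xs ys P Z k)) := by
        gcongr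
        linarith
    _ = _ := by field_simp

end StrongSetting

end RandomRun

end Problem

end RandPD

theorem theoremF2_general {m n : ℕ} {p : Fin n → ℕ} {d : Fin m → ℕ}
    (Pb : RandPD.Problem p d) (Lh μf σ : Fin n → ℝ) (μg : Fin m → ℝ)
    (hA : Pb.Standing Lh)
    (hμf : ∀ j, 0 < μf j) (hf : ∀ j, RandPD.EStrongConvex (μf j) (Pb.f j))
    (hμg : ∀ i, 0 < μg i) (hg : ∀ i, RandPD.EStrongConvex (μg i) (Pb.g i))
    (hσ : ∀ j, 0 < σ j) (hβ : 0 < RandPD.LhSigma σ Lh + Pb.Lbar σ)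
    (qhat : Fin m → ℝ) (q : Fin n → ℝ)
    (c : ℝ) (hcτ : 2 < c * RandPD.tauZero qhat q)
    (ρ₀ : ℝ) (hρ₀ : 0 < ρ₀) (hρg : ρ₀ ≤ RandPD.muMin μg / 8)
    (hρf : ρ₀ * Pb.Lbar σ ≤ RandPD.muSigma σ μf / 8)
    (M : ℝ) (hM : 0 ≤ M) (hLip : RandPD.LipschitzAt M Pb.gSum (Pb.K '' RandPD.edom Pb.fSum))
    (x₀ : RandPD.Block p) (hx₀ : x₀ ∈ RandPD.edom Pb.fSum) (y₀ : RandPD.Block d)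
    {Ω : Type*} [MeasurableSpace Ω] (P : Measure Ω) [IsProbabilityMeasure P]
    (I : ℕ → Ω → Fin m) (J : ℕ → Ω → Fin n) (hIJ : RandPD.IsSampling P qhat q I J)
    (x : ℕ → Ω → RandPD.Block p)
    (hx : ∀ k ω, x k ω = (Pb.run σ (RandPD.tauZero qhat q)
      (RandPD.strongParams c (RandPD.tauZero qhat q) ρ₀ (RandPD.LhSigma σ Lh) (Pb.Lbar σ))
      x₀ y₀ (fun l => (I l ω, J l ω)) k).x) :
    (∀ k, (∀ᵐ ω ∂P, Pb.F (x k ω) < ⊤) ∧ Integrable (fun ω => (Pb.F (x k ω)).toReal) P) ∧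
    (∀ xs ∈ Pb.primalSol, ∀ ys ∈ Pb.dualSol, ∀ k : ℕ,
      ∫ ω, ((Pb.F (x k ω)).toReal - Pb.Fstar.toReal) ∂P ≤
        (c ^ 2 * Pb.E0sq σ Lh μf μg qhat q ρ₀ x₀ xs y₀ ys
          + c ^ 2 * (M + ‖ys‖) * √(Pb.E0sq σ Lh μf μg qhat q ρ₀ x₀ xs y₀ ys) * √(2 / ρ₀))
          / (k + c - 1) ^ 2) ∧
    liminf (fun k : ℕ => (((k : ℝ) ^ 2 * √(Real.log k) *
      ∫ ω, ((Pb.F (x k ω)).toReal - Pb.Fstar.toReal) ∂P : ℝ) : EReal)) atTop = 0 ∧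
    RandPD.SmallOLiminf (fun k => (∫ ω, (Pb.F (x k ω)).toReal ∂P) - Pb.Fstar.toReal)
      (fun k => 1 / ((k : ℝ) ^ 2 * √(Real.log k))) := by
  have hS := hA.strongSetting hμf hf hμg hg hσ hβ hIJ hcτ hρ₀ hρg hρf
  have hc := hS.one_lt_of_two_le_mul hcτ.le
  have hKx₀ := hA.map_mem_edom hLip hx₀
  obtain ⟨Z, hZ⟩ : ∃ Z : ℕ → Ω → ℝ × RandPD.State p d, ∀ k ω, Z k ω = Pb.valuedRun Lh σ
    (RandPD.tauZero qhat q) ρ₀ c x₀ y₀ (fun l => (I l ω, J l ω)) k := ⟨_, fun _ _ => rfl⟩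
  have hfeas (k : ℕ) (ω : Ω) : Pb.Feasible (Z k ω).1 (Z k ω).2 :=
    hZ k ω ▸ hS.feasible_valuedRun (one_pos.trans hc) hx₀ hKx₀ y₀ _ k
  have hxZ (k : ℕ) (ω : Ω) : x k ω = (Z k ω).2.x := by
    rw [hx, hZ, Pb.valuedRun_snd Lh σ hS.τ₀_pos.ne' (one_pos.trans hc)]
  have hF (k : ℕ) (ω : Ω) : Pb.F (x k ω) = (Pb.FR (Z k ω).2.x : EReal) := by
    rw [hxZ, hA.F_eq (hfeas k ω).x_mem (hA.map_mem_edom hLip (hfeas k ω).x_mem)]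
  have hintegrable : ∀ k, Integrable (fun ω => Pb.FR (Z k ω).2.x) P :=
    RandPD.Problem.integrable_comp_valuedRun hIJ hZ fun z => Pb.FR z.2.x
  have hlim := hS.liminf_integral_FR_sub_Fstar_eq_zero hIJ hZ hfeas hM hLip hcτ
  simp only [hF, EReal.toReal_coe, EReal.coe_lt_top, eventually_true, true_and]
  refine ⟨hintegrable, fun xs hxs ys hys k => ?_, hlim, RandPD.smallOLiminf_one_div_iff.2 ?_⟩
  · obtain ⟨hdom, hKdom⟩ := hA.mem_edom_of_mem_primalSol hxs
    rw [hA.Fstar_eq hxs, EReal.toReal_coe]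
    have hE₀ := hS.expectedLyapunov_zero_le hc.le hx₀ hKx₀ hxs y₀ ys P
      fun ω => (hZ 0 ω).trans (Pb.valuedRun_zero ..)
    exact hS.integral_FR_sub_le_div_sq hIJ hZ hfeas hdom hKdom
      (hA.isMultiplier_of_mem_dualSol hxs hys) hM hLip hcτ.le hE₀ k
  · have hsub (k : ℕ) := integral_sub (hintegrable k) (integrable_const Pb.Fstar.toReal)
    simpa only [hsub, integral_const, probReal_univ, one_smul] using hlim

theorem theoremF2 {m n : ℕ} [NeZero m] [NeZero n] {p : Fin n → ℕ} {d : Fin m → ℕ}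
    (Pb : RandPD.Problem p d) (Lh μf σ : Fin n → ℝ) (μg : Fin m → ℝ)
    (hA : Pb.Standing Lh)
    -- strong convexity of `f` and `g`
    (hμf : ∀ j, 0 < μf j) (hf : ∀ j, RandPD.EStrongConvex (μf j) (Pb.f j))
    (hμg : ∀ i, 0 < μg i) (hg : ∀ i, RandPD.EStrongConvex (μg i) (Pb.g i))
    (hσ : ∀ j, 0 < σ j)
    -- the step sizes `β_k` are well defined
    (hβ : 0 < RandPD.LhSigma σ Lh + Pb.Lbar σ)
    -- uniform sampling
    (qhat : Fin m → ℝ) (hqhat : ∀ i, qhat i = 1 / m)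
    (q : Fin n → ℝ) (hq : ∀ j, q j = 1 / n)
    -- parameters
    (c : ℝ) (hc : 2 ≤ c) (hcτ : 2 < c * RandPD.tauZero qhat q)
    (ρ₀ : ℝ) (hρ₀ : 0 < ρ₀) (hρg : ρ₀ ≤ RandPD.muMin μg / 8)
    (hρf : ρ₀ * Pb.Lbar σ ≤ RandPD.muSigma σ μf / 8)
    -- Lipschitz continuity of `g`
    (M : ℝ) (hM : 0 ≤ M) (hLip : RandPD.LipschitzAt M Pb.gSum (Pb.K '' RandPD.edom Pb.fSum))
    -- initial point and random indices
    (x₀ : RandPD.Block p) (hx₀ : x₀ ∈ RandPD.edom Pb.fSum) (y₀ : RandPD.Block d)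
    {Ω : Type*} [MeasurableSpace Ω] (P : Measure Ω) [IsProbabilityMeasure P]
    (I : ℕ → Ω → Fin m) (J : ℕ → Ω → Fin n) (hIJ : RandPD.IsSampling P qhat q I J)
    -- the iterates `x^k`
    (x : ℕ → Ω → RandPD.Block p)
    (hx : ∀ k ω, x k ω = (Pb.run σ (RandPD.tauZero qhat q)
      (RandPD.strongParams c (RandPD.tauZero qhat q) ρ₀ (RandPD.LhSigma σ Lh) (Pb.Lbar σ))
      x₀ y₀ (fun l => (I l ω, J l ω)) k).x) :
    (∀ k, (∀ᵐ ω ∂P, Pb.F (x k ω) < ⊤) ∧ Integrable (fun ω => (Pb.F (x k ω)).toReal) P) ∧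
    (∀ xs ∈ Pb.primalSol, ∀ ys ∈ Pb.dualSol, ∀ k : ℕ,
      ∫ ω, ((Pb.F (x k ω)).toReal - Pb.Fstar.toReal) ∂P ≤
        (c ^ 2 * Pb.E0sq σ Lh μf μg qhat q ρ₀ x₀ xs y₀ ys
          + c ^ 2 * (M + ‖ys‖) * √(Pb.E0sq σ Lh μf μg qhat q ρ₀ x₀ xs y₀ ys) * √(2 / ρ₀))
          / (k + c - 1) ^ 2) ∧
    liminf (fun k : ℕ => (((k : ℝ) ^ 2 * √(Real.log k) *
      ∫ ω, ((Pb.F (x k ω)).toReal - Pb.Fstar.toReal) ∂P : ℝ) : EReal)) atTop = 0 ∧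
    RandPD.SmallOLiminf (fun k => (∫ ω, (Pb.F (x k ω)).toReal ∂P) - Pb.Fstar.toReal)
      (fun k => 1 / ((k : ℝ) ^ 2 * √(Real.log k))) :=
  theoremF2_general Pb Lh μf σ μg hA hμf hf hμg hg hσ hβ qhat q c hcτ ρ₀ hρ₀ hρg hρf M hM hLip
    x₀ hx₀ y₀ P I J hIJ x hx
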